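/- All $C^*$-algebras are over $\mathbb{C}$ and need not be unital or separable; "simple" means nonzero with no closed two-sided ideals other than $0$ and the whole algebra. A *2-quasitrace* on a $C^*$-algebra $D$ is a function $\tau:D\to\mathbb{C}$ such that (i) $0\le\tau(x^*x)=\tau(xx^*)$ for all $x\in D$; (ii) $\tau(a+ib)=\tau(a)+i\tau(b)$ for all self-adjoint $a,b\in D$; (iii) $\tau$ is linear on every commutative $C^*$-subalgebra of $D$; and (iv) there is a function $\tau_2:M_2(D)\to\mathbb{C}$ satisfying (i)–(iii) on $M_2(D)$ with $\tau_2(\mathrm{diag}(x,0))=\tau(x)$ for all $x\in D$. A *trace* on $D$ is a linear functional $\tau:D\to\mathbb{C}$ satisfying (i). The *Pedersen ideal* $\mathrm{Ped}(D)$ is the algebraic two-sided ideal of $D$ generated by the elements $f(d)$, where $d\in D_+$ and $f\ge 0$ is a continuous function vanishing in a neighbourhood of $0$. Let $\mathcal{T}$ be the class of all $C^*$-algebras $D$ such that, for every $a\in \mathrm{Ped}(D)$ with $a\ge 0$ and $a\neq 0$, every 2-quasitrace of the hereditary $C^*$-subalgebra $\overline{aDa}$ is a trace. For positive $a,b\in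 D$ write $a\lesssim b$ if there is a sequence $(x_i)$ in $D$ with $x_i^*bx_i\to a$ in norm. For a class $\mathcal{P}$ of $C^*$-algebras, a simple $C^*$-algebra $A$ is *essentially tracially in* $\mathcal{P}$ if for every finite subset $\mathcal{F}\subset A$, every $\varepsilon>0$ and every nonzero $s\in A_+$ there are a positive element $e\in A$ with $\|e\|\le 1$ and a nonzero $C^*$-subalgebra $B$ of $A$ which is in $\mathcal{P}$ such that 1. $\|ex-xe\|<\varepsilon$ for all $x\in\mathcal{F}$; 2. for all $x\in\mathcal{F}$ there is $b\in B$ with $\|(1-e)x-b\|<\varepsilon$, and $\|(1-e)x\|\ge\|x\|-\varepsilon$, where $(1-e)x:=x-ex$; 3. $e\lesssim s$. **Proposition.** Let $A$ be a simple $C^*$-algebra which is essentially tracially in $\mathcal{T}$. Then $A$ is in $\mathcal{T}$. -/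

import Mathlib

universe u

open Filter Topology

open scoped ComplexOrder

namespace CStarTracial

section Quasitraces

/-- A quasitrace (also called a 1-quasitrace) on a C⋆-algebra `A`: a function `τ : A → ℂ` with
`0 ≤ τ (x⋆ x) = τ (x x⋆)`, `τ (a + i b) = τ a + i τ b` for self-adjoint `a`, `b`, and which is
linear on every commutative C⋆-subalgebra (closed commutative star-subalgebra).
The definition uses only the ⋆-algebra structure and the topology of `A`. -/
structure IsQuasitrace {A : Type u} [NonUnitalRing A] [StarRing A] [Module ℂ A]
    [TopologicalSpace A] (τ : A → ℂ) : Prop where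
  nonneg : ∀ x : A, 0 ≤ τ (star x * x)
  tracial : ∀ x : A, τ (star x * x) = τ (x * star x)
  add_I_smul : ∀ a b : A, IsSelfAdjoint a → IsSelfAdjoint b →
    τ (a + Complex.I • b) = τ a + Complex.I * τ b
  linear_on_comm : ∀ S : NonUnitalStarSubalgebra ℂ A, IsClosed (S : Set A) →
    (∀ x ∈ S, ∀ y ∈ S, x * y = y * x) → IsLinearMap ℂ (fun x : S => τ (x : A))

/-- A 2-quasitrace on `A`: a quasitrace `τ` for which there is a quasitrace `τ₂` on the C⋆-algebra
`M₂(A)` with `τ₂ (diag(x, 0)) = τ x`. (The norm topology of `M₂(A)` is the entrywise topology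
carried by `CStarMatrix`.) -/
def IsTwoQuasitrace {A : Type u} [NonUnitalCStarAlgebra A] (τ : A → ℂ) : Prop :=
  IsQuasitrace τ ∧
    ∃ τ₂ : CStarMatrix (Fin 2) (Fin 2) A → ℂ, IsQuasitrace τ₂ ∧
      ∀ x : A, τ₂ (CStarMatrix.ofMatrix !![x, 0; 0, 0]) = τ x

/-- A (finite) trace on `A`: a positive linear functional `τ` with `τ (x⋆ x) = τ (x x⋆)`. -/
structure IsTrace {A : Type u} [NonUnitalCStarAlgebra A] (τ : A → ℂ) : Prop where
  linear : IsLinearMap ℂ τ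
  nonneg : ∀ x : A, 0 ≤ τ (star x * x)
  tracial : ∀ x : A, τ (star x * x) = τ (x * star x)

end Quasitraces

section Notions

variable {A : Type u} [NonUnitalCStarAlgebra A]

/-- The positive elements of a C⋆-algebra. -/
def IsPos (a : A) : Prop := ∃ x : A, a = star x * x

theorem IsPos.isSelfAdjoint {a : A} (ha : IsPos a) : IsSelfAdjoint a := by
  obtain ⟨x, rfl⟩ := ha
  exact IsSelfAdjoint.star_mul_self x

/-- Cuntz subequivalence `a ≲ b`: `a = lim xᵢ⋆ b xᵢ` for some sequence `xᵢ` in `A`. -/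
def CuntzLE (a b : A) : Prop :=
  ∃ x : ℕ → A, Tendsto (fun i => star (x i) * b * x i) atTop (𝓝 a)

/-- The star-subalgebra `a A a`, for self-adjoint `a`. -/
def corner (a : A) (ha : IsSelfAdjoint a) : NonUnitalStarSubalgebra ℂ A where
  carrier := {y | ∃ x : A, y = a * x * a}
  add_mem' := by
    rintro _ _ ⟨x, rfl⟩ ⟨y, rfl⟩
    exact ⟨x + y, by rw [mul_add, add_mul]⟩
  zero_mem' := ⟨0, by simp⟩
  mul_mem' := by
    rintro _ _ ⟨x, rfl⟩ ⟨y, rfl⟩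
    exact ⟨x * a * a * y, by simp only [mul_assoc]⟩
  smul_mem' := by
    rintro c _ ⟨x, rfl⟩
    exact ⟨c • x, by rw [mul_smul_comm, smul_mul_assoc]⟩
  star_mem' := by
    rintro _ ⟨x, rfl⟩
    exact ⟨star x, by simp only [star_mul, ha.star_eq, mul_assoc]⟩

/-- The hereditary C⋆-subalgebra `closure (a A a)`, for self-adjoint `a`. -/
def her (a : A) (ha : IsSelfAdjoint a) : NonUnitalStarSubalgebra ℂ A :=
  (corner a ha).topologicalClosure

instance isClosed_her (a : A) (ha : IsSelfAdjoint a) : IsClosed (her a ha : Set A) :=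
  (corner a ha).isClosed_topologicalClosure

variable (A)

/-- The elements `f(a)`, where `a ∈ A₊` and `f ≥ 0` is a continuous function vanishing in a
neighbourhood of `0` (in the spectrum of `a`, a subset of `[0, ∞)`). -/
def pedersenGenerators : Set A :=
  {b | ∃ a : A, IsPos a ∧ ∃ f : ℝ → ℝ, Continuous f ∧ (∀ t, 0 ≤ f t) ∧
    (∃ δ > 0, ∀ t ≤ δ, f t = 0) ∧ b = cfcₙ f a}

/-- The Pedersen ideal of `A`: the (algebraic) two-sided ideal generated by the elements `f(a)` as
above. It is automatically a complex subspace, as `f(a) = f(a) g(a)` for a suitable `g`. -/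
def Ped : TwoSidedIdeal A := TwoSidedIdeal.span (pedersenGenerators A)

/-- The class `𝒯`: every 2-quasitrace of `closure (a A a)` is a trace, for every nonzero positive
element `a` of the Pedersen ideal. -/
def InClassT : Prop :=
  ∀ (a : A) (ha : IsPos a), a ∈ Ped A → a ≠ 0 →
    ∀ τ : her a ha.isSelfAdjoint → ℂ, IsTwoQuasitrace τ → IsTrace τ

/-- A C⋆-algebra is simple if it is nonzero and has no closed two-sided ideals but `0` and `A`. -/
def IsSimpleCStar : Prop :=
  Nontrivial A ∧ ∀ I : TwoSidedIdeal A, IsClosed (I : Set A) → I = ⊥ ∨ I = ⊤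

/-- `A` is essentially tracially in the class `P` of C⋆-algebras. The product `(1 - e) x`, taken in
the unitization, is the element `x - e x` of `A`. -/
def EssentiallyTraciallyIn (P : ∀ (B : Type u) [NonUnitalCStarAlgebra B], Prop) : Prop :=
  ∀ (F : Finset A) (ε : ℝ), 0 < ε → ∀ s : A, IsPos s → s ≠ 0 →
    ∃ e : A, IsPos e ∧ ‖e‖ ≤ 1 ∧
      ∃ (B : NonUnitalStarSubalgebra ℂ A) (_ : IsClosed (B : Set A)), B ≠ ⊥ ∧ P B ∧
        (∀ x ∈ F, ‖e * x - x * e‖ < ε) ∧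
        (∀ x ∈ F, (∃ b ∈ B, ‖(x - e * x) - b‖ < ε) ∧ ‖x‖ - ε ≤ ‖x - e * x‖) ∧
        CuntzLE e s

end Notions

end CStarTracial

/-! Let `D = her a` and let `T` be the real part of a 2-quasitrace on `D`, extended by zero.
Quasitraces are real on positive elements and are determined by their values there, so it suffices
that `T` is additive on positive elements of `D`.

The amplification to 2×2 matrices enters the estimates through one inequality,
`IsTwoQuasitrace.comparison`: if `g y₁ = y₁` and `h y₂ = y₂`, then `T (y₁⋆y₁ + y₂⋆y₂)` is at most
its norm times `T g + T h`, because `diag(g, h)` is a left unit for the column `(y₁, y₂)`. Applied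
to thin spectral layers and summed, it gives `le_add_of_conjugate_le`: if `u⋆u ≤ v⋆v + w⋆w + ε` and
`h w = w`, then `T (uu⋆)` exceeds `T (vv⋆)` by a small amount plus a multiple of `T h`. Monotonicity
and boundedness of `T` follow.

Now there are two cases. Suppose first that `T g` can be made arbitrarily small among positive `g`
in `D` with `g s = s` for some nonzero positive `s`. Apply the tracial approximation with this `s`
to the square roots of `x` and `y`. Then `(1-e)x(1-e)` and `(1-e)y(1-e)` are close to elements `dXd`
and `dYd` of `B`, with `d` in the Pedersen ideal of `B`, and conjugation by a suitable `ω` carries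
`her d` (formed in `B`) homomorphically into `D`. The quasitrace pulled back along it is a trace
since `B` is in the class, so `T` is additive on the images. Passing from `x` to the image of `dXd`
costs a small error plus a multiple of `T g`, because `x` is dominated by `(1-e)x(1-e)`, a multiple
of `e`, and a small term, while `e` is nearly `ξ⋆sξ`. This is `reExtend_add_of_small`.

Otherwise `T g` is bounded below by some `η > 0`. As `T` is bounded, positive elements of `D` have
finite spectrum and every projection is a finite sum of minimal ones, which are all equivalent
because `A` is simple. So `D` is zero or a matrix algebra, and `T` is recovered from the additive
map `x ↦ ∑ v⋆xv` into a minimal corner. This is `map_add_of_lt`. -/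

namespace CStarTracial

/-! ### Functional calculus estimates and factorization under domination -/

section FunctionalCalculus

variable {A : Type u} [NonUnitalCStarAlgebra A]

theorem cfcₙ_mul_cfcₙ {f g : ℝ → ℝ} (hf : Continuous f) (hf0 : f 0 = 0) (hg : Continuous g)
    (hg0 : g 0 = 0) (a : A) : cfcₙ f a * cfcₙ g a = cfcₙ (fun t => f t * g t) a :=
  (cfcₙ_mul f g a hf.continuousOn hf0 hg.continuousOn hg0).symm

theorem isSelfAdjoint_cfcₙ (f : ℝ → ℝ) (a : A) : IsSelfAdjoint (cfcₙ f a) :=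
  cfcₙ_predicate f a

theorem mul_cfcₙ_self {f : ℝ → ℝ} (hf : Continuous f) (hf0 : f 0 = 0) {a : A}
    (ha : IsSelfAdjoint a) : a * cfcₙ f a = cfcₙ (fun t => t * f t) a := by
  nth_rewrite 1 [← cfcₙ_id' ℝ a]
  exact cfcₙ_mul_cfcₙ continuous_id rfl hf hf0 a

theorem cfcₙ_mul_self {f : ℝ → ℝ} (hf : Continuous f) (hf0 : f 0 = 0) {a : A}
    (ha : IsSelfAdjoint a) : cfcₙ f a * a = cfcₙ (fun t => f t * t) a := by
  nth_rewrite 2 [← cfcₙ_id' ℝ a]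
  exact cfcₙ_mul_cfcₙ hf hf0 continuous_id rfl a

variable [PartialOrder A] [StarOrderedRing A]

theorem isPos_iff_nonneg {a : A} : IsPos a ↔ 0 ≤ a :=
  CStarAlgebra.nonneg_iff_eq_star_mul_self.symm

theorem cfcₙ_congr_of_nonneg {f g : ℝ → ℝ} {a : A} (ha : 0 ≤ a) (h : ∀ t, 0 ≤ t → f t = g t) :
    cfcₙ f a = cfcₙ g a :=
  cfcₙ_congr fun t ht => h t (quasispectrum_nonneg_of_nonneg a ha t ht)

theorem cfcₙ_eq_self_of_nonneg {f : ℝ → ℝ} {a : A} (ha : 0 ≤ a) (h : ∀ t, 0 ≤ t → f t = t) :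
    cfcₙ f a = a := by
  rw [cfcₙ_congr_of_nonneg ha h, cfcₙ_id' ℝ a]

theorem cfcₙ_nonneg_of_nonneg {f : ℝ → ℝ} {a : A} (ha : 0 ≤ a) (h : ∀ t, 0 ≤ t → 0 ≤ f t) :
    0 ≤ cfcₙ f a :=
  cfcₙ_nonneg fun t ht => h t (quasispectrum_nonneg_of_nonneg a ha t ht)

theorem cfcₙ_le_cfcₙ_of_nonneg {f g : ℝ → ℝ} (hf : Continuous f) (hf0 : f 0 = 0)
    (hg : Continuous g) (hg0 : g 0 = 0) {a : A} (ha : 0 ≤ a) (h : ∀ t, 0 ≤ t → f t ≤ g t) :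
    cfcₙ f a ≤ cfcₙ g a :=
  cfcₙ_mono (fun t ht => h t (quasispectrum_nonneg_of_nonneg a ha t ht)) hf.continuousOn
    hg.continuousOn hf0 hg0

theorem norm_cfcₙ_le_of_nonneg {f : ℝ → ℝ} {a : A} (ha : 0 ≤ a) {M : ℝ}
    (h : ∀ t, 0 ≤ t → |f t| ≤ M) : ‖cfcₙ f a‖ ≤ M :=
  norm_cfcₙ_le fun t ht => h t (quasispectrum_nonneg_of_nonneg a ha t ht)

theorem sub_mul_sub_nonneg {x m : A} (hx : 0 ≤ x) (hm : IsSelfAdjoint m) :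
    0 ≤ x - m * x - x * m + m * x * m := by
  obtain ⟨s, rfl⟩ := CStarAlgebra.nonneg_iff_eq_star_mul_self.1 hx
  have : star s * s - m * (star s * s) - star s * s * m + m * (star s * s) * m
      = star (s - s * m) * (s - s * m) := by
    simp only [star_sub, star_mul, hm.star_eq]
    noncomm_ring
  rw [this]
  exact star_mul_self_nonneg _

/-- Compressing `rr⋆ ≤ b` by `1 - f(b)` on both sides bounds the square of the norm by that of the
function `t(1 - f t)²` of `b`. -/
theorem norm_sub_cfcₙ_mul_sq_le {f : ℝ → ℝ} (hf : Continuous f) (hf0 : f 0 = 0) {r b : A}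
    (hb : 0 ≤ b) (hr : r * star r ≤ b) {M : ℝ} (hM : ∀ t, 0 ≤ t → t * (1 - f t) ^ 2 ≤ M) :
    ‖r - cfcₙ f b * r‖ ^ 2 ≤ M := by
  set m := cfcₙ f b with hm
  have hms : IsSelfAdjoint m := isSelfAdjoint_cfcₙ f b
  have hbs : IsSelfAdjoint b := IsSelfAdjoint.of_nonneg hb
  have e1 : (r - m * r) * star (r - m * r)
      = r * star r - m * (r * star r) - r * star r * m + m * (r * star r) * m := by
    simp only [star_sub, star_mul, hms.star_eq]
    noncomm_ring
  have e2 : b - m * b - b * m + m * b * m = cfcₙ (fun t => t * (1 - f t) ^ 2) b := by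
    have hf1 : Continuous fun t => f t * t := by fun_prop
    rw [hm, cfcₙ_mul_self hf hf0 hbs, mul_cfcₙ_self hf hf0 hbs,
      cfcₙ_mul_cfcₙ hf1 (by simp) hf hf0]
    nth_rewrite 1 [← cfcₙ_id' ℝ b]
    rw [← cfcₙ_sub .., ← cfcₙ_sub .., ← cfcₙ_add ..]
    congr 1
    ext t
    ring
  have h1 : (r - m * r) * star (r - m * r) ≤ cfcₙ (fun t => t * (1 - f t) ^ 2) b := by
    rw [e1, ← e2, ← sub_nonneg]
    have := sub_mul_sub_nonneg (sub_nonneg.2 hr) hms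
    refine this.trans_eq ?_
    noncomm_ring
  have h2 := CStarAlgebra.norm_le_norm_of_nonneg_of_le (mul_star_self_nonneg _) h1
  rw [CStarRing.norm_self_mul_star, ← pow_two] at h2
  refine h2.trans (norm_cfcₙ_le_of_nonneg hb fun t ht => ?_)
  rw [abs_of_nonneg (by positivity)]
  exact hM t ht

/-- In norm estimates both `z` and `r` may be replaced by the square root of `b`, which leaves a
function of `b` alone. -/
theorem norm_mul_cfcₙ_mul_le {f : ℝ → ℝ} (hf : Continuous f) (hf0 : f 0 = 0) {z r b : A}
    (hb : 0 ≤ b) (hz : star z * z ≤ b) (hr : r * star r ≤ b) {M : ℝ} (hM0 : 0 ≤ M)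
    (hM : ∀ t, 0 ≤ t → |t * f t| ≤ M) : ‖z * cfcₙ f b * r‖ ≤ M := by
  set d := cfcₙ f b with hd
  set q := cfcₙ Real.sqrt b with hq
  have hds : IsSelfAdjoint d := isSelfAdjoint_cfcₙ f b
  have hqs : IsSelfAdjoint q := isSelfAdjoint_cfcₙ _ b
  have hqq : q * q = b := by
    rw [hq, cfcₙ_mul_cfcₙ Real.continuous_sqrt Real.sqrt_zero Real.continuous_sqrt Real.sqrt_zero]
    exact cfcₙ_eq_self_of_nonneg hb fun t ht => Real.mul_self_sqrt ht
  have h1 : ‖z * d * r‖ ^ 2 ≤ ‖q * d * r‖ ^ 2 := by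
    rw [pow_two, pow_two, ← CStarRing.norm_star_mul_self, ← CStarRing.norm_star_mul_self]
    refine CStarAlgebra.norm_le_norm_of_nonneg_of_le (star_mul_self_nonneg _) ?_
    have := star_left_conjugate_le_conjugate hz (d * r)
    simp only [star_mul, hds.star_eq, hqs.star_eq, ← hqq, mul_assoc] at this ⊢
    exact this
  have h2 : ‖q * d * r‖ ^ 2 ≤ ‖q * d * q‖ ^ 2 := by
    rw [pow_two, pow_two, ← CStarRing.norm_self_mul_star, ← CStarRing.norm_self_mul_star]
    refine CStarAlgebra.norm_le_norm_of_nonneg_of_le (mul_star_self_nonneg _) ?_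
    have := star_right_conjugate_le_conjugate hr (q * d)
    simp only [star_mul, hds.star_eq, hqs.star_eq, ← hqq, mul_assoc] at this ⊢
    exact this
  have h3 : q * d * q = cfcₙ (fun t => t * f t) b := by
    have hc : Continuous fun t => √t * f t := by fun_prop
    rw [hq, hd, cfcₙ_mul_cfcₙ Real.continuous_sqrt Real.sqrt_zero hf hf0,
      cfcₙ_mul_cfcₙ hc (by simp) Real.continuous_sqrt Real.sqrt_zero]
    refine cfcₙ_congr_of_nonneg hb fun t ht => ?_
    rw [mul_right_comm, Real.mul_self_sqrt ht]
  have h4 : ‖q * d * q‖ ≤ M := by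
    rw [h3]
    exact norm_cfcₙ_le_of_nonneg hb hM
  exact (abs_le_of_sq_le_sq' (h1.trans (h2.trans (by gcongr))) hM0).2

/-- If `0 ≤ a ≤ z₁⋆ z₁ + z₂⋆ z₂` then `a` itself is of this form, with elements which are limits of
`zᵢ cₙ √a`. -/
theorem exists_tendsto_star_mul_add_eq {a z₁ z₂ : A} (ha : 0 ≤ a)
    (h : a ≤ star z₁ * z₁ + star z₂ * z₂) :
    ∃ (c : ℕ → A) (y₁ y₂ : A), Tendsto (fun n => z₁ * c n * cfcₙ Real.sqrt a) atTop (𝓝 y₁) ∧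
      Tendsto (fun n => z₂ * c n * cfcₙ Real.sqrt a) atTop (𝓝 y₂) ∧
      star y₁ * y₁ + star y₂ * y₂ = a := by
  set b := star z₁ * z₁ + star z₂ * z₂ with hbdef
  set r := cfcₙ Real.sqrt a with hrdef
  have hb : 0 ≤ b := ha.trans h
  have hz₁ : star z₁ * z₁ ≤ b := le_add_of_nonneg_right (star_mul_self_nonneg _)
  have hz₂ : star z₂ * z₂ ≤ b := le_add_of_nonneg_left (star_mul_self_nonneg _)
  have hrs : IsSelfAdjoint r := isSelfAdjoint_cfcₙ _ a
  have hrr : r * r = a := by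
    rw [hrdef, cfcₙ_mul_cfcₙ Real.continuous_sqrt Real.sqrt_zero Real.continuous_sqrt
      Real.sqrt_zero]
    exact cfcₙ_eq_self_of_nonneg ha fun t ht => Real.mul_self_sqrt ht
  have hr : r * star r ≤ b := by rw [hrs.star_eq, hrr]; exact h
  let ε : ℕ → ℝ := fun n => 1 / ((n : ℝ) + 1)
  have hε : ∀ n, 0 < ε n := fun n => by positivity
  have hεt : Tendsto ε atTop (𝓝 0) := tendsto_one_div_add_atTop_nhds_zero_nat
  -- `φ n` regularizes `t ↦ t^(-1/2)`, so that `z φₙ(b) r` approximates the formal expression `z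
  -- b^(-1/2) r`. The `max` keeps the denominator positive on all of `ℝ`.
  let φ : ℕ → ℝ → ℝ := fun n t => √t / (max t 0 + ε n ^ 2)
  have hpos : ∀ n t, 0 < max t 0 + ε n ^ 2 := fun n t => by
    have := hε n
    have := le_max_right t 0
    positivity
  have hφ : ∀ n, Continuous (φ n) := fun n =>
    Real.continuous_sqrt.div (by fun_prop) fun t => (hpos n t).ne'
  have hφ0 : ∀ n, φ n 0 = 0 := fun n => by simp [φ]
  have key : ∀ n t, 0 ≤ t → |t * φ n t - √t| ≤ ε n := by
    intro n t ht
    have h0 := hε n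
    obtain ⟨s, hs, rfl⟩ : ∃ s, 0 ≤ s ∧ t = s ^ 2 := ⟨√t, Real.sqrt_nonneg _, (Real.sq_sqrt ht).symm⟩
    have h1 : s ^ 2 * φ n (s ^ 2) - √(s ^ 2) = -(ε n * (ε n * s / (s ^ 2 + ε n ^ 2))) := by
      simp only [φ, Real.sqrt_sq hs, max_eq_left ht]
      field_simp
      ring
    rw [h1, abs_neg, abs_of_nonneg (by positivity)]
    refine mul_le_of_le_one_right h0.le ?_
    rw [div_le_one (by positivity)]
    nlinarith [sq_nonneg (s - ε n)]
  have hcau : ∀ z : A, star z * z ≤ b → ∃ y, Tendsto (fun n => z * cfcₙ (φ n) b * r) atTop (𝓝 y) := by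
    intro z hz
    refine cauchySeq_tendsto_of_complete (cauchySeq_of_le_tendsto_0 (fun n => 2 * ε n) ?_ ?_)
    · intro n m N hn hm
      rw [dist_eq_norm]
      have e : z * cfcₙ (φ n) b * r - z * cfcₙ (φ m) b * r
          = z * cfcₙ (fun t => φ n t - φ m t) b * r := by
        rw [cfcₙ_sub _ _ b (hφ n).continuousOn (hφ0 n) (hφ m).continuousOn (hφ0 m)]
        noncomm_ring
      rw [e]
      refine norm_mul_cfcₙ_mul_le ((hφ n).sub (hφ m)) (by simp [hφ0]) hb hz hr
        (by have := hε N; positivity) fun t ht => ?_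
      have k1 := key n t ht
      have k2 := key m t ht
      have l1 : ε n ≤ ε N := Nat.one_div_le_one_div hn
      have l2 : ε m ≤ ε N := Nat.one_div_le_one_div hm
      change |t * (φ n t - φ m t)| ≤ _
      rw [mul_sub]
      rw [abs_le] at k1 k2 ⊢
      constructor <;> linarith
    · simpa using hεt.const_mul 2
  obtain ⟨y₁, hy₁⟩ := hcau z₁ hz₁
  obtain ⟨y₂, hy₂⟩ := hcau z₂ hz₂
  refine ⟨fun n => cfcₙ (φ n) b, y₁, y₂, hy₁, hy₂, ?_⟩
  -- `ψₙ(b)` approximates the support projection of `b`, which acts as a unit on `r` because `rr⋆ ≤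
  -- b`.
  let ψ : ℕ → ℝ → ℝ := fun n t => φ n t * t * φ n t
  have hψ : ∀ n, Continuous (ψ n) := fun n => by have := hφ n; fun_prop
  have hψ0 : ∀ n, ψ n 0 = 0 := fun n => by simp [ψ]
  have hlim := (hy₁.star.mul hy₁).add (hy₂.star.mul hy₂)
  have e : ∀ n, star (z₁ * cfcₙ (φ n) b * r) * (z₁ * cfcₙ (φ n) b * r)
      + star (z₂ * cfcₙ (φ n) b * r) * (z₂ * cfcₙ (φ n) b * r) = r * (cfcₙ (ψ n) b * r) := by
    intro n
    have hc : Continuous fun t => φ n t * t := by have := hφ n; fun_prop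
    rw [← cfcₙ_mul_cfcₙ hc (by simp) (hφ n) (hφ0 n), ← cfcₙ_mul_self (hφ n) (hφ0 n)
      (IsSelfAdjoint.of_nonneg hb), hbdef]
    simp only [star_mul, hrs.star_eq, (isSelfAdjoint_cfcₙ _ _).star_eq]
    noncomm_ring
  simp only [e] at hlim
  have hψlim : Tendsto (fun n => cfcₙ (ψ n) b * r) atTop (𝓝 r) := by
    rw [tendsto_iff_norm_sub_tendsto_zero]
    refine squeeze_zero (fun _ => norm_nonneg _) (g := fun n => 2 * ε n) (fun n => ?_)
      (by simpa using hεt.const_mul 2)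
    have h0 := hε n
    rw [norm_sub_rev]
    have : ‖r - cfcₙ (ψ n) b * r‖ ^ 2 ≤ (2 * ε n) ^ 2 := by
      refine norm_sub_cfcₙ_mul_sq_le (hψ n) (hψ0 n) hb hr fun t ht => ?_
      have e1 : ψ n t = (t / (t + ε n ^ 2)) ^ 2 := by
        have e2 : φ n t = √t / (t + ε n ^ 2) := by
          change √t / (max t 0 + ε n ^ 2) = _
          rw [max_eq_left ht]
        change φ n t * t * φ n t = _
        rw [e2]
        generalize t + ε n ^ 2 = d
        have e3 : √t / d * t * (√t / d) = √t * √t * t / d ^ 2 := by ring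
        rw [e3, Real.mul_self_sqrt ht]
        ring
      have hs : 0 ≤ t / (t + ε n ^ 2) := by positivity
      have hs1 : t / (t + ε n ^ 2) ≤ 1 := by
        rw [div_le_one (by positivity)]; nlinarith
      have hs2 : t * (1 - t / (t + ε n ^ 2)) ≤ ε n ^ 2 := by
        have : t * (1 - t / (t + ε n ^ 2)) = ε n ^ 2 * (t / (t + ε n ^ 2)) := by
          field_simp
          ring
        rw [this]
        exact mul_le_of_le_one_right (by positivity) hs1
      rw [e1]
      set s := t / (t + ε n ^ 2)
      have : t * (1 - s ^ 2) ^ 2 = t * (1 - s) * ((1 - s) * (1 + s) ^ 2) := by ring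
      rw [this, mul_pow]
      have h4 : (1 - s) * (1 + s) ^ 2 ≤ 2 ^ 2 := by nlinarith
      have h5 : 0 ≤ (1 - s) * (1 + s) ^ 2 := mul_nonneg (by linarith) (by positivity)
      nlinarith [sq_nonneg (ε n)]
    exact (abs_le_of_sq_le_sq' this (by positivity)).2
  have hfin := (tendsto_const_nhds (x := r)).mul hψlim
  rw [hrr] at hfin
  exact tendsto_nhds_unique hlim hfin

end FunctionalCalculus

end CStarTracial

/-! ### Comparison of quasitrace values under approximate domination -/

namespace CStarTracial

/-- The continuous function which is `0` on `(-∞, s]`, `δ` on `[s + δ, ∞)` and affine between. -/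
noncomputable def ramp (δ s t : ℝ) : ℝ := min δ (max (t - s) 0)

theorem continuous_ramp (δ s : ℝ) : Continuous (ramp δ s) := by
  unfold ramp
  fun_prop

theorem ramp_of_le {δ s t : ℝ} (hδ : 0 ≤ δ) (h : t ≤ s) : ramp δ s t = 0 := by
  rw [ramp, max_eq_right (by linarith), min_eq_right hδ]

theorem ramp_of_ge {δ s t : ℝ} (h : s + δ ≤ t) : ramp δ s t = δ := by
  rw [ramp, min_eq_left (le_max_of_le_left (by linarith))]

theorem ramp_nonneg {δ : ℝ} (hδ : 0 ≤ δ) (s t : ℝ) : 0 ≤ ramp δ s t :=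
  le_min hδ (le_max_right _ _)

theorem ramp_le (δ s t : ℝ) : ramp δ s t ≤ δ := min_le_left _ _

theorem min_add_ramp {δ : ℝ} (hδ : 0 ≤ δ) (s t : ℝ) :
    min t s + ramp δ s t = min t (s + δ) := by
  rcases le_total t s with h | h
  · rw [ramp_of_le hδ h, min_eq_left h, min_eq_left (by linarith), add_zero]
  · rw [ramp, max_eq_left (by linarith), min_eq_right h, ← min_add_add_left, min_comm]
    congr 1
    ring

section QuasitraceOn

variable {A : Type u} [NonUnitalCStarAlgebra A] [PartialOrder A] [StarOrderedRing A]

/-- The properties of (the real part of) a 2-quasitrace on a hereditary C⋆-subalgebra `D` of `A`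
which enter the comparison arguments. -/
structure QuasitraceOn (D : NonUnitalStarSubalgebra ℂ A) (T : A → ℝ) : Prop where
  isClosed : IsClosed (D : Set A)
  mul_mul_mem : ∀ x ∈ D, ∀ a, ∀ y ∈ D, x * a * y ∈ D
  star_mul_self_nonneg : ∀ x ∈ D, 0 ≤ T (star x * x)
  tracial : ∀ x ∈ D, T (star x * x) = T (x * star x)
  add_of_commute : ∀ x ∈ D, ∀ y ∈ D, IsSelfAdjoint x → IsSelfAdjoint y → Commute x y →
    T (x + y) = T x + T y
  smul : ∀ r : ℝ, ∀ x ∈ D, IsSelfAdjoint x → T (r • x) = r * T x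
  comparison : ∀ y₁ ∈ D, ∀ y₂ ∈ D, ∀ g ∈ D, ∀ h ∈ D, 0 ≤ g → 0 ≤ h → g * y₁ = y₁ → h * y₂ = y₂ →
    T (star y₁ * y₁ + star y₂ * y₂) ≤ ‖star y₁ * y₁ + star y₂ * y₂‖ * (T g + T h)

namespace QuasitraceOn

variable {D : NonUnitalStarSubalgebra ℂ A} {T : A → ℝ}

theorem cfcₙ_mem (hT : QuasitraceOn D T) (f : ℝ → ℝ) {a : A} (ha : a ∈ D) : cfcₙ f a ∈ D :=
  have := hT.isClosed
  _root_.cfcₙ_mem (𝕜' := ℂ) f ha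

theorem nonneg (hT : QuasitraceOn D T) {x : A} (hx : x ∈ D) (h0 : 0 ≤ x) : 0 ≤ T x := by
  have h := hT.star_mul_self_nonneg _ (hT.cfcₙ_mem Real.sqrt hx)
  rwa [(isSelfAdjoint_cfcₙ _ x).star_eq, cfcₙ_mul_cfcₙ Real.continuous_sqrt Real.sqrt_zero
    Real.continuous_sqrt Real.sqrt_zero,
    cfcₙ_eq_self_of_nonneg h0 fun t ht => Real.mul_self_sqrt ht] at h

theorem cfcₙ_add (hT : QuasitraceOn D T) {f g : ℝ → ℝ} (hf : Continuous f) (hf0 : f 0 = 0)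
    (hg : Continuous g) (hg0 : g 0 = 0) {x : A} (hx : x ∈ D) :
    T (cfcₙ (fun t => f t + g t) x) = T (cfcₙ f x) + T (cfcₙ g x) := by
  rw [_root_.cfcₙ_add f g x hf.continuousOn hf0 hg.continuousOn hg0]
  exact hT.add_of_commute _ (hT.cfcₙ_mem f hx) _ (hT.cfcₙ_mem g hx) (isSelfAdjoint_cfcₙ _ _)
    (isSelfAdjoint_cfcₙ _ _) (cfcₙ_commute_cfcₙ _ _ _)

theorem cfcₙ_mono (hT : QuasitraceOn D T) {f g : ℝ → ℝ} (hf : Continuous f) (hf0 : f 0 = 0)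
    (hg : Continuous g) (hg0 : g 0 = 0) {x : A} (hx : x ∈ D) (h0 : 0 ≤ x)
    (h : ∀ t, 0 ≤ t → f t ≤ g t) : T (cfcₙ f x) ≤ T (cfcₙ g x) := by
  have h1 := hT.cfcₙ_add hf hf0 (hg.sub hf) (by simp [hf0, hg0]) hx
  have h2 : (fun t => f t + (g - f) t) = g := by
    ext t
    simp
  rw [h2] at h1
  rw [h1]
  exact le_add_of_nonneg_right (hT.nonneg (hT.cfcₙ_mem _ hx)
    (cfcₙ_nonneg_of_nonneg h0 fun t ht => sub_nonneg.2 (h t ht)))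

/-- The factorization of `a` has entries `yᵢ = lim zᵢ cₙ √a`. These inherit the left units `g` and
`h`, and they lie in `D` because `z cₙ √a = g (z cₙ) √a` has both outer factors in `D`. So
`comparison` applies, although the `zᵢ` themselves need not lie in `D`. -/
theorem le_of_le_star_mul_add (hT : QuasitraceOn D T) {a z₁ z₂ g h : A} (ha : a ∈ D) (ha0 : 0 ≤ a)
    (hg : g ∈ D) (hg0 : 0 ≤ g) (hh : h ∈ D) (hh0 : 0 ≤ h) (hgz : g * z₁ = z₁) (hhz : h * z₂ = z₂)
    (hle : a ≤ star z₁ * z₁ + star z₂ * z₂) : T a ≤ ‖a‖ * (T g + T h) := by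
  obtain ⟨c, y₁, y₂, h₁, h₂, rfl⟩ := exists_tendsto_star_mul_add_eq ha0 hle
  set r := cfcₙ Real.sqrt (star y₁ * y₁ + star y₂ * y₂)
  have hr : r ∈ D := hT.cfcₙ_mem _ ha
  have key : ∀ {z y e : A}, e ∈ D → e * z = z → Tendsto (fun n => z * c n * r) atTop (𝓝 y) →
      y ∈ D ∧ e * y = y := by
    intro z y e he hez hy
    refine ⟨hT.isClosed.mem_of_tendsto hy (Eventually.of_forall fun n => ?_), ?_⟩
    · change z * c n * r ∈ D
      rw [← hez, mul_assoc e]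
      exact hT.mul_mul_mem e he _ r hr
    · refine tendsto_nhds_unique ?_ hy
      have := hy.const_mul e
      simpa only [← mul_assoc, hez] using this
  obtain ⟨hy₁, hgy⟩ := key hg hgz h₁
  obtain ⟨hy₂, hhy⟩ := key hh hhz h₂
  exact hT.comparison _ hy₁ _ hy₂ _ hg _ hh hg0 hh0 hgy hhy

/-- The condition `hle` says `u⋆u ≤ v⋆v + w⋆w + ε·1`; it is tested against `k⋆ · k` since `A` may
have no unit. Of the shift `4δ` between the two layers, the part of `v` below height `s + 2δ`
absorbs `s + 2δ` of the total `s + 4δ` and the error `ε` absorbs `δ`; the remaining `δ κ⋆κ` is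
exactly the layer of `uu⋆`. -/
theorem ramp_le_ramp (hT : QuasitraceOn D T) {u v w h : A} (hu : u * star u ∈ D)
    (hv : v * star v ∈ D) (hh : h ∈ D) (hh0 : 0 ≤ h) (hw : h * w = w) {ε δ : ℝ} (hεδ : ε ≤ δ)
    (hδ : 0 < δ) (hle : ∀ k : A, star k * (star u * u) * k ≤ star k * (star v * v) * k
      + star k * (star w * w) * k + ε • (star k * k)) {s : ℝ} (hs : 0 ≤ s) :
    T (cfcₙ (ramp δ (s + 4 * δ)) (u * star u)) ≤ T (cfcₙ (ramp δ s) (v * star v)) + δ * T h := by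
  set P := u * star u with hP
  set Q := v * star v with hQ
  have hP0 : 0 ≤ P := mul_star_self_nonneg u
  have hQ0 : 0 ≤ Q := mul_star_self_nonneg v
  have hPs := IsSelfAdjoint.of_nonneg hP0
  -- Chosen so that `t k(t)² = ramp/δ`: then `κ = u⋆ k(P)` satisfies `δ κ⋆κ = ramp(P)`.
  let k : ℝ → ℝ := fun t => √(ramp δ (s + 4 * δ) t / (δ * max t (s + 4 * δ)))
  have hpos : ∀ t, 0 < max t (s + 4 * δ) := fun t => lt_max_of_lt_right (by positivity)
  have hk : Continuous k := by
    refine Real.continuous_sqrt.comp ((continuous_ramp _ _).div (by fun_prop) fun t => ?_)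
    have := hpos t
    positivity
  have hr0 : ramp δ (s + 4 * δ) 0 = 0 := ramp_of_le hδ.le (by positivity)
  have hk0 : k 0 = 0 := by simp [k, hr0]
  have hkk : ∀ t, k t * t * k t = ramp δ (s + 4 * δ) t / δ := by
    intro t
    have e : k t * k t = ramp δ (s + 4 * δ) t / (δ * max t (s + 4 * δ)) :=
      Real.mul_self_sqrt (div_nonneg (ramp_nonneg hδ.le _ _) (by have := hpos t; positivity))
    rw [mul_right_comm, e]
    rcases le_total t (s + 4 * δ) with h | h
    · simp [ramp_of_le hδ.le h]
    · have h1 := hpos t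
      rw [max_eq_left h] at h1 ⊢
      field_simp
  let m : ℝ → ℝ := fun t => ramp δ (s + δ) t / δ
  have hm : Continuous m := (continuous_ramp _ _).div_const _
  have hm0 : m 0 = 0 := by simp [m, ramp_of_le hδ.le (show (0 : ℝ) ≤ s + δ by positivity)]
  have hm01 : ∀ t, 0 ≤ m t ∧ m t ≤ 1 := fun t =>
    ⟨div_nonneg (ramp_nonneg hδ.le _ _) hδ.le, (div_le_one hδ).2 (ramp_le _ _ _)⟩
  -- `l² = 1 - (1 - m)²`, so `v⋆v` splits into `(l(Q)v)⋆(l(Q)v)` and the low part `W⋆W`; `g = 1`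
  -- wherever `l ≠ 0`.
  let l : ℝ → ℝ := fun t => √(2 * m t - m t * m t)
  have hl : Continuous l := by
    dsimp only [l]
    fun_prop
  have hl0 : l 0 = 0 := by simp [l, hm0]
  have hll : ∀ t, l t * l t = 2 * m t - m t * m t := fun t => by
    have := hm01 t
    exact Real.mul_self_sqrt (by nlinarith)
  let g : ℝ → ℝ := fun t => δ⁻¹ * ramp δ s t
  have hg : Continuous g := (continuous_ramp _ _).const_mul _
  have hg0 : g 0 = 0 := by simp [g, ramp_of_le hδ.le hs]
  have hgl : ∀ t, g t * l t = l t := by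
    intro t
    rcases le_total t (s + δ) with h | h
    · simp [l, m, ramp_of_le hδ.le h]
    · simp only [g, ramp_of_ge h]
      field_simp
  set κ := star u * cfcₙ k P with hκ
  have hκκ : star κ * κ = cfcₙ (fun t => ramp δ (s + 4 * δ) t / δ) P := by
    have h1 : star κ * κ = cfcₙ k P * P * cfcₙ k P := by
      rw [hκ, star_mul, star_star, (isSelfAdjoint_cfcₙ k P).star_eq, hP]
      simp only [mul_assoc]
    have hc : Continuous fun t => k t * t := by fun_prop
    rw [h1, cfcₙ_mul_self hk hk0 hPs, cfcₙ_mul_cfcₙ hc (by simp) hk hk0]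
    simp only [hkk]
  have hrP : cfcₙ (ramp δ (s + 4 * δ)) P = δ • (star κ * κ) := by
    rw [hκκ, ← cfcₙ_smul _ _ _ ((continuous_ramp _ _).div_const _).continuousOn (by simp [hr0])]
    congr 1
    ext t
    simp only [smul_eq_mul]
    field_simp
  have hκuκ : (s + 4 * δ) • (star κ * κ) ≤ star κ * (star u * u) * κ := by
    have h1 : star κ * (star u * u) * κ = cfcₙ k P * P * (P * cfcₙ k P) := by
      rw [hκ, star_mul, star_star, (isSelfAdjoint_cfcₙ k P).star_eq, hP]
      simp only [mul_assoc]
    have hc : Continuous fun t => k t * t := by fun_prop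
    have hc' : Continuous fun t => t * k t := by fun_prop
    rw [h1, hκκ, cfcₙ_mul_self hk hk0 hPs, mul_cfcₙ_self hk hk0 hPs,
      cfcₙ_mul_cfcₙ hc (by simp) hc' (by simp),
      ← cfcₙ_smul _ _ _ ((continuous_ramp _ _).div_const _).continuousOn (by simp [hr0])]
    refine cfcₙ_le_cfcₙ_of_nonneg (((continuous_ramp δ (s + 4 * δ)).div_const δ).const_smul (s + 4 * δ))
      (show (s + 4 * δ) • (ramp δ (s + 4 * δ) 0 / δ) = 0 by simp [hr0]) (hc.mul hc') (by simp) hP0 fun t ht => ?_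
    have e : k t * t * (t * k t) = k t * t * k t * t := by ring
    change (s + 4 * δ) • (ramp δ (s + 4 * δ) t / δ) ≤ k t * t * (t * k t)
    rw [e, hkk, smul_eq_mul, mul_comm]
    rcases le_total t (s + 4 * δ) with h | h
    · simp [ramp_of_le hδ.le h]
    · exact mul_le_mul_of_nonneg_left h (div_nonneg (ramp_nonneg hδ.le _ _) hδ.le)
  set W := v - cfcₙ m Q * v with hW
  have hWn : ‖W‖ ^ 2 ≤ s + 2 * δ := by
    refine norm_sub_cfcₙ_mul_sq_le hm hm0 hQ0 le_rfl fun t ht => ?_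
    rcases le_total t (s + 2 * δ) with h | h
    · have := hm01 t
      have h1 : (1 - m t) ^ 2 ≤ 1 := by nlinarith
      nlinarith
    · have : m t = 1 := by
        simp only [m]
        rw [ramp_of_ge (by linarith), div_self hδ.ne']
      rw [this]
      have h0 : t * (1 - 1) ^ 2 = 0 := by ring
      rw [h0]
      positivity
  have hWκ : star κ * (star W * W) * κ ≤ (s + 2 * δ) • (star κ * κ) := by
    refine (CStarAlgebra.star_left_conjugate_le_norm_smul
      (IsSelfAdjoint.star_mul_self W)).trans ?_
    refine smul_le_smul_of_nonneg_right ?_ (_root_.star_mul_self_nonneg κ)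
    rwa [CStarRing.norm_star_mul_self, ← pow_two]
  have hvW : star v * v = star v * cfcₙ l Q * (cfcₙ l Q * v) + star W * W := by
    have e : cfcₙ l Q * cfcₙ l Q = 2 • cfcₙ m Q - cfcₙ m Q * cfcₙ m Q := by
      rw [cfcₙ_mul_cfcₙ hl hl0 hl hl0, cfcₙ_mul_cfcₙ hm hm0 hm hm0]
      simp only [hll]
      rw [cfcₙ_sub _ _ _ (by fun_prop) (by simp [hm0]) (by fun_prop) (by simp [hm0]),
        two_smul, ← _root_.cfcₙ_add m m Q hm.continuousOn hm0 hm.continuousOn hm0]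
      simp only [two_mul]
    have e' : star v * cfcₙ l Q * (cfcₙ l Q * v) = star v * (cfcₙ l Q * cfcₙ l Q) * v := by
      simp only [mul_assoc]
    rw [e', e, hW, star_sub, star_mul, (isSelfAdjoint_cfcₙ m Q).star_eq]
    noncomm_ring
  have hmain : cfcₙ (ramp δ (s + 4 * δ)) P ≤ star (cfcₙ l Q * v * κ) * (cfcₙ l Q * v * κ)
      + star (w * κ) * (w * κ) := by
    have h1 := hκuκ.trans (hle κ)
    have e1 : star κ * (star v * v) * κ = star (cfcₙ l Q * v * κ) * (cfcₙ l Q * v * κ)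
        + star κ * (star W * W) * κ := by
      rw [hvW]
      simp only [star_mul, (isSelfAdjoint_cfcₙ l Q).star_eq, mul_add, add_mul, mul_assoc]
    have e2 : star κ * (star w * w) * κ = star (w * κ) * (w * κ) := by
      simp only [star_mul, mul_assoc]
    rw [e1, e2] at h1
    have h2 : ε • (star κ * κ) ≤ δ • (star κ * κ) :=
      smul_le_smul_of_nonneg_right hεδ (_root_.star_mul_self_nonneg κ)
    have h3 := h1.trans (add_le_add (add_le_add (add_le_add le_rfl hWκ) le_rfl) h2)
    rw [hrP]
    have e3 : (s + 4 * δ) • (star κ * κ) = δ • (star κ * κ) + ((s + 2 * δ) • (star κ * κ)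
        + δ • (star κ * κ)) := by module
    rw [e3] at h3
    rw [← add_le_add_iff_right ((s + 2 * δ) • (star κ * κ) + δ • (star κ * κ))]
    refine h3.trans_eq ?_
    abel
  have hgQ : cfcₙ g Q = δ⁻¹ • cfcₙ (ramp δ s) Q :=
    cfcₙ_smul δ⁻¹ _ Q (continuous_ramp _ _).continuousOn (ramp_of_le hδ.le hs)
  have hfin := hT.le_of_le_star_mul_add (hT.cfcₙ_mem (ramp δ (s + 4 * δ)) hu)
    (cfcₙ_nonneg_of_nonneg hP0 fun t _ => ramp_nonneg hδ.le _ _) (hT.cfcₙ_mem g hv)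
    (cfcₙ_nonneg_of_nonneg hQ0 fun t _ => mul_nonneg (by positivity) (ramp_nonneg hδ.le _ _))
    hh hh0 (z₁ := cfcₙ l Q * v * κ) (z₂ := w * κ)
    (by simp only [← mul_assoc]; rw [cfcₙ_mul_cfcₙ hg hg0 hl hl0]; simp only [hgl])
    (by rw [← mul_assoc, hw]) hmain
  rw [hgQ, hT.smul _ _ (hT.cfcₙ_mem _ hv) (isSelfAdjoint_cfcₙ _ _)] at hfin
  have hn : ‖cfcₙ (ramp δ (s + 4 * δ)) P‖ ≤ δ := norm_cfcₙ_le_of_nonneg hP0 fun t _ => by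
    rw [abs_of_nonneg (ramp_nonneg hδ.le _ _)]
    exact ramp_le _ _ _
  have hTQ : 0 ≤ T (cfcₙ (ramp δ s) Q) := hT.nonneg (hT.cfcₙ_mem _ hv)
    (cfcₙ_nonneg_of_nonneg hQ0 fun t _ => ramp_nonneg hδ.le _ _)
  have hTh := hT.nonneg hh hh0
  refine hfin.trans ((mul_le_mul_of_nonneg_right hn (by positivity)).trans_eq ?_)
  field_simp

/-- Summing `ramp_le_ramp` over the layers `s = 0, δ, 2δ, …` telescopes to truncations `min t c`.
The lowest `4δ` of `uu⋆` is not compared with anything and remains as a separate term. -/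
theorem le_add_of_conjugate_le (hT : QuasitraceOn D T) {u v w h : A} (hu : u * star u ∈ D)
    (hv : v * star v ∈ D) (hh : h ∈ D) (hh0 : 0 ≤ h) (hw : h * w = w) {ε δ : ℝ} (hεδ : ε ≤ δ)
    (hδ : 0 < δ) (hle : ∀ k : A, star k * (star u * u) * k ≤ star k * (star v * v) * k
      + star k * (star w * w) * k + ε • (star k * k)) :
    T (u * star u) ≤ T (v * star v) + T (cfcₙ (fun t => min t (4 * δ)) (u * star u))
      + (‖u * star u‖ + δ) * T h := by
  set P := u * star u with hP
  set Q := v * star v with hQ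
  have hP0 : 0 ≤ P := mul_star_self_nonneg u
  have hQ0 : 0 ≤ Q := mul_star_self_nonneg v
  have hTh := hT.nonneg hh hh0
  have hmc : ∀ c : ℝ, Continuous fun t : ℝ => min t c := fun c => by fun_prop
  have hstep : ∀ n : ℕ, T (cfcₙ (fun t => min t (n * δ + 4 * δ)) P)
      ≤ T (cfcₙ (fun t => min t (n * δ)) Q) + T (cfcₙ (fun t => min t (4 * δ)) P)
        + n * δ * T h := by
    intro n
    induction n with
    | zero =>
      have : 0 ≤ T (cfcₙ (fun t : ℝ => min t ((0 : ℕ) * δ)) Q) := by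
        refine hT.nonneg (hT.cfcₙ_mem _ hv) (cfcₙ_nonneg_of_nonneg hQ0 fun t ht => ?_)
        simpa using ht
      simpa using this
    | succ n ih =>
      have hn : 0 ≤ n * δ := by positivity
      have e1 := hT.cfcₙ_add (hmc (n * δ + 4 * δ)) (min_eq_left (by positivity))
        (continuous_ramp δ (n * δ + 4 * δ)) (ramp_of_le hδ.le (by positivity)) hu
      have e2 := hT.cfcₙ_add (hmc (n * δ)) (min_eq_left hn)
        (continuous_ramp δ (n * δ)) (ramp_of_le hδ.le hn) hv
      simp only [min_add_ramp hδ.le] at e1 e2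
      have e3 := hT.ramp_le_ramp hu hv hh hh0 hw hεδ hδ hle hn
      have e4 : ((n + 1 : ℕ) : ℝ) * δ + 4 * δ = n * δ + 4 * δ + δ := by push_cast; ring
      have e5 : ((n + 1 : ℕ) : ℝ) * δ = n * δ + δ := by push_cast; ring
      rw [e4, e5, e1, e2]
      linarith
  -- Enough layers to exhaust the spectrum of `P`; the overshoot is at most `δ`, whence the factor
  -- `‖P‖ + δ`.
  set n := ⌈‖P‖ / δ⌉₊ with hn
  have h1 : ‖P‖ ≤ n * δ := (div_le_iff₀ hδ).1 (Nat.le_ceil _)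
  have h2 : n * δ ≤ ‖P‖ + δ := by
    have := (Nat.ceil_lt_add_one (div_nonneg (norm_nonneg P) hδ.le)).le
    rw [← hn] at this
    calc n * δ ≤ (‖P‖ / δ + 1) * δ := by gcongr
      _ = ‖P‖ + δ := by field_simp
  have e1 : cfcₙ (fun t => min t (n * δ + 4 * δ)) P = P := by
    conv_rhs => rw [← cfcₙ_id' ℝ P (IsSelfAdjoint.of_nonneg hP0)]
    refine cfcₙ_congr fun t ht => min_eq_left ?_
    have := NonUnitalIsometricContinuousFunctionalCalculus.norm_quasispectrum_le P ht
      (IsSelfAdjoint.of_nonneg hP0)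
    have := (le_abs_self t).trans this
    linarith
  have e2 : T (cfcₙ (fun t => min t (n * δ)) Q) ≤ T Q := by
    conv_rhs => rw [← cfcₙ_id' ℝ Q (IsSelfAdjoint.of_nonneg hQ0)]
    exact hT.cfcₙ_mono (hmc _) (min_eq_left (by positivity)) continuous_id rfl hv hQ0
      fun t _ => min_le_left _ _
  have h3 := hstep n
  rw [e1] at h3
  have h4 : n * δ * T h ≤ (‖P‖ + δ) * T h := by gcongr
  linarith

end QuasitraceOn

end QuasitraceOn

end CStarTracial

/-! ### Monotonicity and automatic boundedness -/

namespace CStarTracial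

section QuasitraceOn

variable {A : Type u} [NonUnitalCStarAlgebra A] [PartialOrder A] [StarOrderedRing A]

theorem cfcₙ_sqrt_mul_self {x : A} (hx : 0 ≤ x) : cfcₙ Real.sqrt x * cfcₙ Real.sqrt x = x := by
  rw [cfcₙ_mul_cfcₙ Real.continuous_sqrt Real.sqrt_zero Real.continuous_sqrt Real.sqrt_zero]
  exact cfcₙ_eq_self_of_nonneg hx fun t ht => Real.mul_self_sqrt ht

theorem cfcₙ_sqrt_mul_star {x : A} (hx : 0 ≤ x) :
    cfcₙ Real.sqrt x * star (cfcₙ Real.sqrt x) = x := by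
  rw [(isSelfAdjoint_cfcₙ _ x).star_eq, cfcₙ_sqrt_mul_self hx]

theorem star_cfcₙ_sqrt_mul {x : A} (hx : 0 ≤ x) :
    star (cfcₙ Real.sqrt x) * cfcₙ Real.sqrt x = x := by
  rw [(isSelfAdjoint_cfcₙ _ x).star_eq, cfcₙ_sqrt_mul_self hx]

namespace QuasitraceOn

variable {D : NonUnitalStarSubalgebra ℂ A} {T : A → ℝ}

theorem map_zero (hT : QuasitraceOn D T) : T 0 = 0 := by
  simpa using hT.smul 0 0 (zero_mem D) (IsSelfAdjoint.zero A)

/-- The comparison theorem with `w = h = 0` and `ε = 0`, as `δ` tends to zero. -/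
theorem mono (hT : QuasitraceOn D T) {x y : A} (hx : x ∈ D) (hy : y ∈ D) (hx0 : 0 ≤ x)
    (hxy : x ≤ y) : T x ≤ T y := by
  set K := T (cfcₙ Real.sqrt x) with hK
  have hK0 : 0 ≤ K := hT.nonneg (hT.cfcₙ_mem _ hx)
    (cfcₙ_nonneg_of_nonneg hx0 fun t _ => Real.sqrt_nonneg t)
  refine le_of_forall_pos_le_add fun ε hε => ?_
  set η := ε / (2 * (K + 1)) with hη
  have hη0 : 0 < η := by positivity
  have h1 := hT.le_add_of_conjugate_le (u := cfcₙ Real.sqrt x) (v := cfcₙ Real.sqrt y) (w := 0)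
    (h := 0) (ε := 0) (δ := η ^ 2) (by rwa [cfcₙ_sqrt_mul_star hx0])
    (by rwa [cfcₙ_sqrt_mul_star (hx0.trans hxy)]) (zero_mem D) le_rfl (by simp) (by positivity)
    (by positivity) (fun k => by
      simpa [star_cfcₙ_sqrt_mul hx0, star_cfcₙ_sqrt_mul (hx0.trans hxy)] using
        star_left_conjugate_le_conjugate hxy k)
  rw [cfcₙ_sqrt_mul_star hx0, cfcₙ_sqrt_mul_star (hx0.trans hxy), hT.map_zero, mul_zero,
    add_zero] at h1
  -- The low layer is controlled by `min t (4η²) ≤ 2η√t`, using only monotonicity inside the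
  -- functional calculus of `x`; boundedness of `T` is itself deduced from the present lemma.
  have h2 : T (cfcₙ (fun t => min t (4 * η ^ 2)) x) ≤ 2 * η * K := by
    rw [hK, ← hT.smul _ _ (hT.cfcₙ_mem _ hx) (isSelfAdjoint_cfcₙ _ _),
      ← cfcₙ_smul _ _ _ Real.continuous_sqrt.continuousOn Real.sqrt_zero]
    refine hT.cfcₙ_mono (f := fun t => min t (4 * η ^ 2)) (g := fun t => (2 * η) • √t)
      (by fun_prop) (min_eq_left (by positivity))
      (Real.continuous_sqrt.const_smul (2 * η)) (show (2 * η) • √0 = 0 by simp) hx hx0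
      fun t ht => ?_
    obtain ⟨s, hs, rfl⟩ : ∃ s, 0 ≤ s ∧ t = s ^ 2 :=
      ⟨√t, Real.sqrt_nonneg _, (Real.sq_sqrt ht).symm⟩
    rw [Real.sqrt_sq hs, smul_eq_mul]
    rcases le_total s (2 * η) with h | h
    · exact (min_le_left _ _).trans (by nlinarith)
    · exact (min_le_right _ _).trans (by nlinarith)
  have h3 : 2 * η * K ≤ ε := by
    rw [hη, mul_div_assoc', div_mul_eq_mul_div, div_le_iff₀ (by positivity)]
    nlinarith
  linarith

/-- If unbounded, `T` takes values at least `4ⁿ` on unit vectors `yₙ ≥ 0`; then `∑ 2⁻ⁿ yₙ` dominates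
each of its terms, so by monotonicity its value exceeds every `2ⁿ`. -/
theorem exists_bound (hT : QuasitraceOn D T) :
    ∃ C : ℝ, 0 ≤ C ∧ ∀ x ∈ D, 0 ≤ x → T x ≤ C * ‖x‖ := by
  by_contra! hcon
  have h1 : ∀ n : ℕ, ∃ y ∈ D, 0 ≤ y ∧ ‖y‖ = 1 ∧ 4 ^ n ≤ T y := by
    intro n
    obtain ⟨x, hx, hx0, hlt⟩ := hcon (4 ^ n) (by positivity)
    have hne : x ≠ 0 := by
      rintro rfl
      simp [hT.map_zero] at hlt
    have hn : 0 < ‖x‖ := norm_pos_iff.2 hne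
    refine ⟨‖x‖⁻¹ • x, ?_, smul_nonneg (by positivity) hx0, ?_, ?_⟩
    · rw [← Complex.coe_smul]
      exact SMulMemClass.smul_mem _ hx
    · rw [norm_smul, norm_inv, norm_norm, inv_mul_cancel₀ hn.ne']
    · rw [hT.smul _ _ hx (IsSelfAdjoint.of_nonneg hx0), inv_mul_eq_div, le_div_iff₀ hn]
      exact hlt.le
  choose y hy hy0 hy1 hyT using h1
  have hmem : ∀ n, ((1 : ℝ) / 2) ^ n • y n ∈ D := fun n => by
    rw [← Complex.coe_smul]
    exact SMulMemClass.smul_mem _ (hy n)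
  have hnn : ∀ n, 0 ≤ ((1 : ℝ) / 2) ^ n • y n := fun n => smul_nonneg (by positivity) (hy0 n)
  have hsum : Summable fun n => ((1 : ℝ) / 2) ^ n • y n := by
    refine Summable.of_norm ?_
    simp only [norm_smul, hy1, mul_one, norm_pow]
    norm_num
  obtain ⟨z, hz⟩ := hsum
  have hzD : z ∈ D := hT.isClosed.mem_of_tendsto hz
    (Eventually.of_forall fun s => sum_mem fun n _ => hmem n)
  have hle : ∀ n, ((1 : ℝ) / 2) ^ n • y n ≤ z := fun n => by
    have hcl : IsClosed {x : A | ((1 : ℝ) / 2) ^ n • y n ≤ x} := by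
      have : {x : A | ((1 : ℝ) / 2) ^ n • y n ≤ x}
          = (fun x => x - ((1 : ℝ) / 2) ^ n • y n) ⁻¹' {a : A | 0 ≤ a} := by
        ext x
        simp
      rw [this]
      exact CStarAlgebra.isClosed_nonneg.preimage (by fun_prop)
    refine hcl.mem_of_tendsto hz ?_
    filter_upwards [eventually_ge_atTop {n}] with s hs
    exact Finset.single_le_sum (f := fun n => ((1 : ℝ) / 2) ^ n • y n) (fun i _ => hnn i)
      (hs (Finset.mem_singleton_self n))
  obtain ⟨n, hn⟩ := pow_unbounded_of_one_lt (T z) (one_lt_two)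
  have h2 := hT.mono (hmem n) hzD (hnn n) (hle n)
  rw [hT.smul _ _ (hy n) (IsSelfAdjoint.of_nonneg (hy0 n))] at h2
  have h3 : (2 : ℝ) ^ n ≤ (1 / 2) ^ n * T (y n) := by
    calc (2 : ℝ) ^ n = (1 / 2) ^ n * 4 ^ n := by rw [← mul_pow]; norm_num
      _ ≤ _ := by gcongr; exact hyT n
  linarith

theorem le_add_of_conjugate_le_of_bound (hT : QuasitraceOn D T) {C : ℝ}
    (hC : ∀ x ∈ D, 0 ≤ x → T x ≤ C * ‖x‖) (hC0 : 0 ≤ C) {u v w h : A} (hu : u * star u ∈ D)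
    (hv : v * star v ∈ D) (hh : h ∈ D) (hh0 : 0 ≤ h) (hw : h * w = w) {ε δ : ℝ} (hεδ : ε ≤ δ)
    (hδ : 0 < δ) (hle : ∀ k : A, star k * (star u * u) * k ≤ star k * (star v * v) * k
      + star k * (star w * w) * k + ε • (star k * k)) :
    T (u * star u) ≤ T (v * star v) + C * (4 * δ) + (‖u * star u‖ + δ) * T h := by
  have h1 := hT.le_add_of_conjugate_le hu hv hh hh0 hw hεδ hδ hle
  have hP0 : 0 ≤ u * star u := mul_star_self_nonneg u
  have h2 := hC _ (hT.cfcₙ_mem (fun t => min t (4 * δ)) hu)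
    (cfcₙ_nonneg_of_nonneg hP0 fun t ht => le_min ht (by positivity))
  have h3 : ‖cfcₙ (fun t => min t (4 * δ)) (u * star u)‖ ≤ 4 * δ :=
    norm_cfcₙ_le_of_nonneg hP0 fun t ht => by
      rw [abs_of_nonneg (le_min ht (by positivity))]
      exact min_le_right _ _
  have h4 : C * ‖cfcₙ (fun t => min t (4 * δ)) (u * star u)‖ ≤ C * (4 * δ) := by gcongr
  linarith

end QuasitraceOn

end QuasitraceOn

end CStarTracial

/-! ### From 2-quasitraces to real functionals on a subalgebra -/

namespace CStarTracial

section QuasitraceToReal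

namespace IsQuasitrace

variable {A : Type u} [NonUnitalCStarAlgebra A] {τ : A → ℂ}

theorem _root_.CStarTracial.exists_isClosed_commutative {x y : A} (hx : IsSelfAdjoint x)
    (hy : IsSelfAdjoint y) (hxy : Commute x y) :
    ∃ S : NonUnitalStarSubalgebra ℂ A, IsClosed (S : Set A) ∧
      (∀ a ∈ S, ∀ b ∈ S, a * b = b * a) ∧ x ∈ S ∧ y ∈ S := by
  have hcomm : ∀ a ∈ ({x, y} : Set A), ∀ b ∈ ({x, y} : Set A), a * b = b * a := by
    rintro a (rfl | rfl) b (rfl | rfl)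
    exacts [rfl, hxy, hxy.symm, rfl]
  have hstar : ∀ b ∈ ({x, y} : Set A), star b = b := by
    rintro b (rfl | rfl)
    exacts [hx, hy]
  have h1 := NonUnitalStarAlgebra.isMulCommutative_adjoin ℂ hcomm
    fun a ha b hb => by rw [hstar b hb, hcomm a ha b hb]
  let S := NonUnitalStarAlgebra.adjoin ℂ ({x, y} : Set A)
  let i := S.nonUnitalCommRingTopologicalClosure fun a b => mul_comm' a b
  refine ⟨S.topologicalClosure, S.isClosed_topologicalClosure, fun a ha b hb => ?_, ?_, ?_⟩
  · exact congrArg Subtype.val (i.mul_comm ⟨a, ha⟩ ⟨b, hb⟩)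
  · exact S.le_topologicalClosure (NonUnitalStarAlgebra.subset_adjoin ℂ _ (by simp))
  · exact S.le_topologicalClosure (NonUnitalStarAlgebra.subset_adjoin ℂ _ (by simp))

theorem map_add_of_commute (hτ : IsQuasitrace τ) {x y : A} (hx : IsSelfAdjoint x)
    (hy : IsSelfAdjoint y) (hxy : Commute x y) : τ (x + y) = τ x + τ y := by
  obtain ⟨S, hS, hc, hxS, hyS⟩ := exists_isClosed_commutative hx hy hxy
  exact (hτ.linear_on_comm S hS hc).map_add ⟨x, hxS⟩ ⟨y, hyS⟩

theorem map_smul (hτ : IsQuasitrace τ) (c : ℂ) {x : A} (hx : IsSelfAdjoint x) :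
    τ (c • x) = c * τ x := by
  obtain ⟨S, hS, hc, hxS, -⟩ := exists_isClosed_commutative hx hx (Commute.refl x)
  exact (hτ.linear_on_comm S hS hc).map_smul c ⟨x, hxS⟩

theorem nonneg_of_nonneg [PartialOrder A] [StarOrderedRing A] (hτ : IsQuasitrace τ) {x : A}
    (hx : 0 ≤ x) : 0 ≤ τ x := by
  obtain ⟨y, rfl⟩ := CStarAlgebra.nonneg_iff_eq_star_mul_self.1 hx
  exact hτ.nonneg y

/-- The element `c = yy⋆` commutes with `g` and satisfies `c ≤ ‖c‖ g`, so additivity on commuting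
pairs is enough to compare `τ c` with `‖c‖ τ g`. -/
theorem le_norm_mul_of_mul_eq [PartialOrder A] [StarOrderedRing A] (hτ : IsQuasitrace τ) {g y : A}
    (hg : 0 ≤ g) (hgy : g * y = y) : τ (star y * y) ≤ ‖star y * y‖ * τ g := by
  set c := y * star y with hc
  have hgs := IsSelfAdjoint.of_nonneg hg
  have hcs : IsSelfAdjoint c := IsSelfAdjoint.mul_star_self y
  have hgc : g * c = c := by rw [hc, ← mul_assoc, hgy]
  have hcg : c * g = c := by
    have := congrArg star hgc
    rwa [star_mul, hcs.star_eq, hgs.star_eq] at this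
  have hcomm : Commute g c := hgc.trans hcg.symm
  set q := cfcₙ Real.sqrt g with hq
  have hqs : IsSelfAdjoint q := isSelfAdjoint_cfcₙ _ g
  have hqq : q * q = g := cfcₙ_sqrt_mul_self hg
  have hqc : Commute q c := hcomm.cfcₙ (by rwa [hgs.star_eq]) _
  have hle : c ≤ ‖c‖ • g := by
    have := CStarAlgebra.star_left_conjugate_le_norm_smul (a := q) hcs
    rwa [hqs.star_eq, hqq, mul_assoc, ← hqc.eq, ← mul_assoc, hqq, hgc] at this
  have h1 : τ (c + (‖c‖ • g - c)) = τ c + τ (‖c‖ • g - c) := by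
    refine hτ.map_add_of_commute hcs (((IsSelfAdjoint.all ‖c‖).smul hgs).sub hcs) ?_
    exact (hcomm.symm.smul_right _).sub_right (Commute.refl c)
  rw [add_sub_cancel, ← Complex.coe_smul, hτ.map_smul _ hgs, Complex.coe_smul] at h1
  rw [hτ.tracial y, CStarRing.norm_star_mul_self, ← CStarRing.norm_self_mul_star, h1]
  exact le_add_of_nonneg_right (hτ.nonneg_of_nonneg (sub_nonneg.2 hle))

end IsQuasitrace

variable {A : Type u} [NonUnitalCStarAlgebra A]

/-- The embedding `x ↦ diag(x, 0)`. -/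
noncomputable def diagHom : A →⋆ₙₐ[ℂ] CStarMatrix (Fin 2) (Fin 2) A where
  toFun x := CStarMatrix.ofMatrix !![x, 0; 0, 0]
  map_smul' c x := by ext i j; fin_cases i <;> fin_cases j <;> simp
  map_zero' := by ext i j; fin_cases i <;> fin_cases j <;> simp
  map_add' x y := by ext i j; fin_cases i <;> fin_cases j <;> simp
  map_mul' x y := by
    ext i j; fin_cases i <;> fin_cases j <;> simp [CStarMatrix.mul_apply, Fin.sum_univ_two]
  map_star' x := by ext i j; fin_cases i <;> fin_cases j <;> simp [CStarMatrix.star_apply]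

variable [PartialOrder A] [StarOrderedRing A]

/-- With `Y` the column `(y₁, y₂)`, `Y⋆Y` sits in the upper left corner and `diag(g, h)` is a left
unit for `Y`, so the one-element estimate applies to `τ₂`. -/
theorem IsTwoQuasitrace.comparison {τ : A → ℂ} (hτ : IsTwoQuasitrace τ) {y₁ y₂ g h : A}
    (hg : 0 ≤ g) (hh : 0 ≤ h) (hgy : g * y₁ = y₁) (hhy : h * y₂ = y₂) :
    τ (star y₁ * y₁ + star y₂ * y₂) ≤ ‖star y₁ * y₁ + star y₂ * y₂‖ * (τ g + τ h) := by
  obtain ⟨-, τ₂, hτ₂, hdiag⟩ := hτ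
  let M : A → A → A → A → CStarMatrix (Fin 2) (Fin 2) A :=
    fun a b c d => CStarMatrix.ofMatrix !![a, b; c, d]
  have hmul : ∀ a b c d a' b' c' d', M a b c d * M a' b' c' d' =
      M (a * a' + b * c') (a * b' + b * d') (c * a' + d * c') (c * b' + d * d') := by
    intros
    ext i j
    fin_cases i <;> fin_cases j <;> simp [M, CStarMatrix.mul_apply, Fin.sum_univ_two]
  have hstar : ∀ a b c d, star (M a b c d) = M (star a) (star c) (star b) (star d) := by
    intros
    ext i j
    fin_cases i <;> fin_cases j <;> simp [M, CStarMatrix.star_apply]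
  have hadd : ∀ a b c d a' b' c' d', M a b c d + M a' b' c' d' =
      M (a + a') (b + b') (c + c') (d + d') := by
    intros
    ext i j
    fin_cases i <;> fin_cases j <;> simp [M]
  set G := M g 0 0 h with hG
  set Y := M y₁ 0 y₂ 0 with hY
  have hG0 : 0 ≤ G := by
    have : G = star (M (cfcₙ Real.sqrt g) 0 0 (cfcₙ Real.sqrt h))
        * M (cfcₙ Real.sqrt g) 0 0 (cfcₙ Real.sqrt h) := by
      rw [hstar, hmul, hG]
      simp [star_cfcₙ_sqrt_mul hg, star_cfcₙ_sqrt_mul hh]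
    rw [this]
    exact star_mul_self_nonneg _
  have hGY : G * Y = Y := by
    rw [hG, hY, hmul]
    simp [hgy, hhy]
  have hYY : star Y * Y = diagHom (star y₁ * y₁ + star y₂ * y₂) := by
    rw [hY, hstar, hmul]
    simp [M, diagHom]
  have hd : ∀ x : A, τ₂ (diagHom x) = τ x := hdiag
  have hτG : τ₂ G = τ g + τ h := by
    have e1 : G = M g 0 0 0 + M 0 0 0 h := by
      rw [hadd]
      simp [hG]
    have e2 : τ₂ (M 0 0 0 h) = τ h := by
      -- The off-diagonal matrix with entry `√h` moves the lower right corner to the upper left one,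
      -- where `τ₂` is known.
      have h1 := hτ₂.tracial (M 0 (cfcₙ Real.sqrt h) 0 0)
      rw [hstar, hmul, hmul] at h1
      simp only [star_zero, mul_zero, zero_mul, add_zero, zero_add,
        star_cfcₙ_sqrt_mul hh, cfcₙ_sqrt_mul_star hh] at h1
      rw [h1]
      exact hdiag h
    have s1 : IsSelfAdjoint (M g 0 0 0) := by
      rw [IsSelfAdjoint, hstar, (IsSelfAdjoint.of_nonneg hg).star_eq]
      simp
    have s2 : IsSelfAdjoint (M 0 0 0 h) := by
      rw [IsSelfAdjoint, hstar, (IsSelfAdjoint.of_nonneg hh).star_eq]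
      simp
    have hc : Commute (M g 0 0 0) (M 0 0 0 h) := by
      rw [Commute, SemiconjBy, hmul, hmul]
      simp
    rw [e1, hτ₂.map_add_of_commute s1 s2 hc, e2]
    congr 1
    exact hdiag g
  have h1 := hτ₂.le_norm_mul_of_mul_eq hG0 hGY
  rw [hYY, hd, hτG] at h1
  refine h1.trans (mul_le_mul_of_nonneg_right ?_ ?_)
  · exact_mod_cast NonUnitalStarAlgHom.norm_apply_le (diagHom (A := A)) _
  · rw [← hτG]
    exact hτ₂.nonneg_of_nonneg hG0

end QuasitraceToReal

section Extension

variable {A : Type u} [NonUnitalCStarAlgebra A]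

open Classical in
/-- The real part of `τ`, extended by zero. -/
noncomputable def reExtend (D : NonUnitalStarSubalgebra ℂ A) (τ : D → ℂ) (x : A) : ℝ :=
  if hx : x ∈ D then (τ ⟨x, hx⟩).re else 0

theorem reExtend_coe {D : NonUnitalStarSubalgebra ℂ A} (τ : D → ℂ) (x : D) :
    reExtend D τ x = (τ x).re := by
  simp [reExtend]

theorem IsTwoQuasitrace.quasitraceOn {D : NonUnitalStarSubalgebra ℂ A} [PartialOrder A]
    [StarOrderedRing A] [hD : IsClosed (D : Set A)]
    (hmul : ∀ x ∈ D, ∀ a, ∀ y ∈ D, x * a * y ∈ D) {τ : D → ℂ} (hτ : IsTwoQuasitrace τ) :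
    QuasitraceOn D (reExtend D τ) where
  isClosed := hD
  mul_mul_mem := hmul
  star_mul_self_nonneg x hx := by
    lift x to D using hx
    have := hτ.1.nonneg x
    change 0 ≤ reExtend D τ ((star x * x : D) : A)
    rw [reExtend_coe]
    exact (Complex.nonneg_iff.1 this).1
  tracial x hx := by
    lift x to D using hx
    have := hτ.1.tracial x
    change reExtend D τ ((star x * x : D) : A) = reExtend D τ ((x * star x : D) : A)
    rw [reExtend_coe, reExtend_coe, this]
  add_of_commute x hx y hy hxs hys hxy := by
    lift x to D using hx
    lift y to D using hy
    have := hτ.1.map_add_of_commute (x := x) (y := y) (Subtype.ext hxs) (Subtype.ext hys)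
      (Subtype.ext hxy)
    change reExtend D τ ((x + y : D) : A) = _
    simp only [reExtend_coe, this, Complex.add_re]
  smul r x hx hxs := by
    lift x to D using hx
    have := hτ.1.map_smul r (x := x) (Subtype.ext hxs)
    rw [← Complex.coe_smul]
    change reExtend D τ (((r : ℂ) • x : D) : A) = _
    rw [reExtend_coe, reExtend_coe, this, Complex.re_ofReal_mul]
  comparison y₁ hy₁ y₂ hy₂ g hg h hh hg0 hh0 hgy hhy := by
    let _ : PartialOrder D := CStarAlgebra.spectralOrder D
    have : StarOrderedRing D := CStarAlgebra.spectralOrderedRing D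
    have hnn : ∀ x : D, 0 ≤ (x : A) → ∃ y : D, x = star y * y := by
      intro x hx
      have hmem : cfcₙ Real.sqrt (x : A) ∈ D := cfcₙ_mem (𝕜' := ℂ) _ x.2
      exact ⟨⟨_, hmem⟩, Subtype.ext (star_cfcₙ_sqrt_mul hx).symm⟩
    lift y₁ to D using hy₁
    lift y₂ to D using hy₂
    lift g to D using hg
    lift h to D using hh
    have := hτ.comparison (y₁ := y₁) (y₂ := y₂) (CStarAlgebra.nonneg_iff_eq_star_mul_self.2 (hnn g hg0))
      (CStarAlgebra.nonneg_iff_eq_star_mul_self.2 (hnn h hh0)) (Subtype.ext hgy)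
      (Subtype.ext hhy)
    change reExtend D τ ((star y₁ * y₁ + star y₂ * y₂ : D) : A)
      ≤ ‖(star y₁ * y₁ + star y₂ * y₂ : D)‖ * (reExtend D τ g + reExtend D τ h)
    simp only [reExtend_coe]
    have := (Complex.le_def.1 this).1
    simpa using this

end Extension

end CStarTracial

/-! ### Pullbacks, additivity on positive elements, hereditary subalgebras -/

namespace CStarTracial

section Pullback

variable {A B : Type u} [NonUnitalCStarAlgebra A] [NonUnitalCStarAlgebra B]

theorem IsQuasitrace.comp {τ : B → ℂ} (hτ : IsQuasitrace τ) (φ : A →⋆ₙₐ[ℂ] B) :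
    IsQuasitrace fun x => τ (φ x) where
  nonneg x := by simpa only [map_mul, map_star] using hτ.nonneg (φ x)
  tracial x := by simpa only [map_mul, map_star] using hτ.tracial (φ x)
  add_I_smul a b ha hb := by simpa using hτ.add_I_smul (φ a) (φ b) (ha.map φ) (hb.map φ)
  linear_on_comm S _ hc := by
    let S' := S.map φ
    have hc' : ∀ x y : S', x * y = y * x := by
      rintro ⟨_, x, hx, rfl⟩ ⟨_, y, hy, rfl⟩
      refine Subtype.ext ?_
      change φ x * φ y = φ y * φ x
      rw [← map_mul, hc x hx y hy, map_mul]
    let i := S'.nonUnitalCommRingTopologicalClosure hc'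
    have h := hτ.linear_on_comm S'.topologicalClosure S'.isClosed_topologicalClosure
      fun a ha b hb => congrArg Subtype.val (i.mul_comm ⟨a, ha⟩ ⟨b, hb⟩)
    have hmem : ∀ x : S, φ x ∈ S'.topologicalClosure := fun x =>
      S'.le_topologicalClosure ⟨x, x.2, rfl⟩
    refine ⟨fun x y => ?_, fun c x => ?_⟩
    · simpa using h.map_add ⟨_, hmem x⟩ ⟨_, hmem y⟩
    · simpa using h.map_smul c ⟨_, hmem x⟩

theorem IsTwoQuasitrace.comp {τ : B → ℂ} (hτ : IsTwoQuasitrace τ) (φ : A →⋆ₙₐ[ℂ] B) :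
    IsTwoQuasitrace fun x => τ (φ x) := by
  let _ : PartialOrder A := CStarAlgebra.spectralOrder A
  have : StarOrderedRing A := CStarAlgebra.spectralOrderedRing A
  let _ : PartialOrder B := CStarAlgebra.spectralOrder B
  have : StarOrderedRing B := CStarAlgebra.spectralOrderedRing B
  obtain ⟨h₁, τ₂, h₂, hd⟩ := hτ
  refine ⟨h₁.comp φ, fun x => τ₂ (CStarMatrix.mapₙₐ φ x), h₂.comp (CStarMatrix.mapₙₐ φ),
    fun x => ?_⟩
  refine Eq.trans (congrArg τ₂ ?_) (hd (φ x))
  ext i j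
  fin_cases i <;> fin_cases j <;> simp

end Pullback

section Additive

variable {A : Type u} [NonUnitalCStarAlgebra A] [PartialOrder A] [StarOrderedRing A] {τ : A → ℂ}

-- Writing `x = p - q` also as `x⁺ - x⁻` gives `x⁺ + q = p + x⁻`, so additivity on positive elements
-- determines `τ` on differences. Real and imaginary parts then extend it to all of `A`.
open scoped ComplexStarModule in
theorem IsQuasitrace.isTrace_of_map_add (hτ : IsQuasitrace τ)
    (h : ∀ x y : A, 0 ≤ x → 0 ≤ y → τ (x + y) = τ x + τ y) : IsTrace τ := by
  have hsub : ∀ p q : A, 0 ≤ p → 0 ≤ q → τ (p - q) = τ p - τ q := by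
    intro p q hp hq
    have hs : IsSelfAdjoint (p - q) := (IsSelfAdjoint.of_nonneg hp).sub (IsSelfAdjoint.of_nonneg hq)
    set x := p - q with hx
    have e := CFC.posPart_sub_negPart x hs
    have hpos : 0 ≤ x⁺ := CFC.posPart_nonneg x
    have hneg : 0 ≤ x⁻ := CFC.negPart_nonneg x
    have hnegs := IsSelfAdjoint.of_nonneg hneg
    have hcomm : Commute x x⁻ := by
      nth_rewrite 1 [← e]
      refine Commute.sub_left ?_ (Commute.refl _)
      rw [Commute, SemiconjBy, CFC.posPart_mul_negPart, CFC.negPart_mul_posPart]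
    have h1 := hτ.map_add_of_commute hs hnegs hcomm
    have e1 : x + x⁻ = x⁺ := by
      nth_rewrite 1 [← e]
      abel
    have e2 : x⁺ + q = p + x⁻ := by
      rw [← e1, hx]
      abel
    have h2 := congrArg τ e2
    rw [h _ _ hpos hq, h _ _ hp hneg] at h2
    rw [e1] at h1
    linear_combination h2 - h1
  have hadd : ∀ x y : A, IsSelfAdjoint x → IsSelfAdjoint y → τ (x + y) = τ x + τ y := by
    intro x y hx hy
    have ex := CFC.posPart_sub_negPart x hx
    have ey := CFC.posPart_sub_negPart y hy
    have hxp : 0 ≤ x⁺ := CFC.posPart_nonneg x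
    have hxn : 0 ≤ x⁻ := CFC.negPart_nonneg x
    have hyp : 0 ≤ y⁺ := CFC.posPart_nonneg y
    have hyn : 0 ≤ y⁻ := CFC.negPart_nonneg y
    have e : x + y = (x⁺ + y⁺) - (x⁻ + y⁻) := by
      nth_rewrite 1 [← ex, ← ey]
      abel
    have h1 := hsub _ _ hxp hxn
    have h2 := hsub _ _ hyp hyn
    rw [ex] at h1
    rw [ey] at h2
    rw [e, hsub _ _ (add_nonneg hxp hyp) (add_nonneg hxn hyn), h _ _ hxp hyp, h _ _ hxn hyn, h1, h2]
    ring
  have hdec : ∀ x : A, τ x = τ (ℜ x : A) + Complex.I * τ (ℑ x : A) := by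
    intro x
    nth_rewrite 1 [← realPart_add_I_smul_imaginaryPart x]
    exact hτ.add_I_smul _ _ (ℜ x).2 (ℑ x).2
  have hadd' : ∀ x y : A, τ (x + y) = τ x + τ y := by
    intro x y
    rw [hdec (x + y), hdec x, hdec y, map_add, map_add, AddSubgroup.coe_add, AddSubgroup.coe_add,
      hadd _ _ (ℜ x).2 (ℜ y).2, hadd _ _ (ℑ x).2 (ℑ y).2]
    ring
  refine ⟨⟨hadd', fun c x => ?_⟩, hτ.nonneg, hτ.tracial⟩
  nth_rewrite 1 [← realPart_add_I_smul_imaginaryPart x]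
  rw [smul_add, hadd', smul_smul, hτ.map_smul c (ℜ x).2, hτ.map_smul (c * Complex.I) (ℑ x).2,
    hdec x, smul_eq_mul]
  ring

end Additive

section Hereditary

variable {A : Type u} [NonUnitalCStarAlgebra A]

theorem corner_le_her (a : A) (ha : IsSelfAdjoint a) : corner a ha ≤ her a ha :=
  (corner a ha).le_topologicalClosure

theorem mul_mul_mem_her {a : A} {ha : IsSelfAdjoint a} {x y : A} (hx : x ∈ her a ha) (b : A)
    (hy : y ∈ her a ha) : x * b * y ∈ her a ha := by
  refine map_mem_closure₂ (f := fun x y => x * b * y) (by fun_prop) hx hy ?_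
  rintro _ ⟨x, rfl⟩ _ ⟨y, rfl⟩
  exact ⟨x * a * b * a * y, by simp only [mul_assoc]⟩

theorem mul_eq_of_mem_her {a p : A} {ha : IsSelfAdjoint a} (hp : p * a = a) {x : A}
    (hx : x ∈ her a ha) : p * x = x := by
  have hcl : IsClosed {x : A | p * x = x} := isClosed_eq (by fun_prop) continuous_id
  refine closure_minimal ?_ hcl hx
  rintro _ ⟨y, rfl⟩
  change p * (a * y * a) = _
  rw [← mul_assoc, ← mul_assoc, hp]

theorem self_mem_her {a : A} (ha : IsPos a) : a ∈ her a ha.isSelfAdjoint := by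
  let _ : PartialOrder A := CStarAlgebra.spectralOrder A
  have : StarOrderedRing A := CStarAlgebra.spectralOrderedRing A
  have h0 : 0 ≤ a := isPos_iff_nonneg.1 ha
  refine Metric.mem_closure_iff.2 fun ε hε => ?_
  -- `f` approximates `t⁻²`, so `t f(t) t` is uniformly close to `t` on `[0, ∞)`.
  let f : ℝ → ℝ := fun t => t / (max t 0 + ε / 4) ^ 2
  have hpos : ∀ t : ℝ, 0 < max t 0 + ε / 4 := fun t => by
    have := le_max_right t 0
    positivity
  have hf : Continuous f := continuous_id.div (by fun_prop) fun t => (pow_pos (hpos t) 2).ne'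
  have hf0 : f 0 = 0 := by simp [f]
  refine ⟨a * cfcₙ f a * a, ⟨_, rfl⟩, ?_⟩
  have hc : Continuous fun t => t * f t := by fun_prop
  rw [dist_eq_norm, mul_cfcₙ_self hf hf0 ha.isSelfAdjoint,
    cfcₙ_mul_self hc (by simp) ha.isSelfAdjoint]
  nth_rewrite 1 [← cfcₙ_id' ℝ a ha.isSelfAdjoint]
  rw [← cfcₙ_sub (fun t => t) (fun t => t * f t * t) a (by fun_prop) rfl (by fun_prop) (by simp)]
  refine (norm_cfcₙ_le_of_nonneg h0 (M := ε / 2) fun t ht => ?_).trans_lt (by linarith)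
  have h1 := hpos t
  simp only [f, max_eq_left ht] at h1 ⊢
  have e : t - t * (t / (t + ε / 4) ^ 2) * t
      = ε / 4 * (t / (t + ε / 4)) * (1 + t / (t + ε / 4)) := by
    field_simp
    ring
  have hs : 0 ≤ t / (t + ε / 4) := by positivity
  have hs1 : t / (t + ε / 4) ≤ 1 := (div_le_one h1).2 (by linarith)
  rw [e]
  generalize t / (t + ε / 4) = s at hs hs1
  rw [abs_of_nonneg (by positivity)]
  nlinarith [mul_nonneg hs (sub_nonneg.2 hs1)]

/-- Compression by `w` is a homomorphism on the hereditary subalgebra generated by `c` if `w⋆ w` is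
a unit for `c`. -/
noncomputable def conjHom {a : A} {ha : IsSelfAdjoint a} {B : NonUnitalStarSubalgebra ℂ A}
    [IsClosed (B : Set A)] {c : B} {hc : IsSelfAdjoint c} {w : A} (hw : ∀ x : A, w * x * star w ∈ her a ha)
    (hwc : star w * w * (c : A) = c) : her c hc →⋆ₙₐ[ℂ] her a ha where
  toFun x := ⟨w * (x : B) * star w, hw _⟩
  map_smul' r x := Subtype.ext (by simp [mul_smul_comm, smul_mul_assoc])
  map_zero' := Subtype.ext (by simp)
  map_add' x y := Subtype.ext (by simp [mul_add, add_mul])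
  map_star' x := Subtype.ext (by simp [mul_assoc])
  map_mul' x y := by
    have hy : star w * w * ((y : B) : A) = (y : B) := by
      have hcl : IsClosed {y : B | star w * w * (y : A) = y} :=
        isClosed_eq (by fun_prop) (by fun_prop)
      refine closure_minimal ?_ hcl y.2
      rintro _ ⟨z, rfl⟩
      change star w * w * ((c : A) * z * c) = c * z * c
      rw [← mul_assoc, ← mul_assoc, hwc]
    refine Subtype.ext ?_
    change w * ((x : B) * (y : B) : A) * star w
      = w * (x : B) * star w * (w * (y : B) * star w)
    calc w * ((x : B) * (y : B) : A) * star w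
        = w * ((x : B) * (star w * w * ((y : B) : A)) : A) * star w := by rw [hy]
      _ = _ := by simp only [mul_assoc]

end Hereditary

end CStarTracial

/-! ### Error of replacing `x` by a compressed approximation -/

namespace CStarTracial

section Approximation

variable {A : Type u} [NonUnitalCStarAlgebra A] [PartialOrder A] [StarOrderedRing A]

/-- With `t = √s`, the product `(t - gt)(t - gt)⋆ = s - gs - sg + gsg` vanishes. -/
theorem mul_cfcₙ_sqrt_eq_of_mul_eq {g s : A} (hg : IsSelfAdjoint g) (hs : 0 ≤ s)
    (hgs : g * s = s) : g * cfcₙ Real.sqrt s = cfcₙ Real.sqrt s := by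
  have hsg : s * g = s := by
    have := congrArg star hgs
    rwa [star_mul, hg.star_eq, (IsSelfAdjoint.of_nonneg hs).star_eq] at this
  have h := CStarRing.mul_star_self_eq_zero_iff (cfcₙ Real.sqrt s - g * cfcₙ Real.sqrt s)
  rw [star_sub, star_mul, (isSelfAdjoint_cfcₙ _ s).star_eq, hg.star_eq] at h
  have e : (cfcₙ Real.sqrt s - g * cfcₙ Real.sqrt s)
      * (cfcₙ Real.sqrt s - cfcₙ Real.sqrt s * g) = 0 := by
    have : (cfcₙ Real.sqrt s - g * cfcₙ Real.sqrt s) * (cfcₙ Real.sqrt s - cfcₙ Real.sqrt s * g)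
        = cfcₙ Real.sqrt s * cfcₙ Real.sqrt s - g * (cfcₙ Real.sqrt s * cfcₙ Real.sqrt s)
          - cfcₙ Real.sqrt s * cfcₙ Real.sqrt s * g
          + g * (cfcₙ Real.sqrt s * cfcₙ Real.sqrt s) * g := by noncomm_ring
    rw [this, cfcₙ_sqrt_mul_self hs, hgs, hsg]
    simp
  exact (sub_eq_zero.1 (h.1 e)).symm

theorem mul_self_le_self_of_norm_le_one {e : A} (he : 0 ≤ e) (he1 : ‖e‖ ≤ 1) : e * e ≤ e := by
  have hs := IsSelfAdjoint.of_nonneg he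
  have h := CStarAlgebra.star_left_conjugate_le_norm_smul (a := cfcₙ Real.sqrt e) hs
  rw [star_cfcₙ_sqrt_mul he, (isSelfAdjoint_cfcₙ _ e).star_eq] at h
  have hc : Commute (cfcₙ Real.sqrt e) e := (Commute.refl e).cfcₙ (by rw [hs.star_eq]) _
  rw [hc.eq, mul_assoc, cfcₙ_sqrt_mul_self he] at h
  refine h.trans ?_
  calc ‖e‖ • e ≤ (1 : ℝ) • e := smul_le_smul_of_nonneg_right he1 he
    _ = e := one_smul _ _

theorem conjugate_le_of_norm_le {d : A} (hd : IsSelfAdjoint d) {M : ℝ} (hM : ‖d‖ ≤ M) (k : A) :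
    star k * d * k ≤ M • (star k * k) :=
  (CStarAlgebra.star_left_conjugate_le_norm_smul hd).trans
    (smul_le_smul_of_nonneg_right hM (star_mul_self_nonneg k))

/-- For positive contractions `e`, the element `x` is dominated by `(1 - e) x (1 - e)` up to a
multiple of `e` and a small multiple of `x²`. -/
theorem le_one_sub_conjugate_add {x e : A} (hx : 0 ≤ x) (he : 0 ≤ e) (he1 : ‖e‖ ≤ 1) {α : ℝ}
    (hα : 0 < α) :
    x ≤ (x - e * x - x * e + e * x * e) + α • (x * x) + α⁻¹ • e := by
  have hxs := IsSelfAdjoint.of_nonneg hx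
  have hes := IsSelfAdjoint.of_nonneg he
  have h1 : 0 ≤ e * x * e := by simpa [hes.star_eq] using star_left_conjugate_nonneg hx e
  -- Completing the square: positivity of `α⁻¹(αx - e)²` bounds the cross terms `xe + ex` by `αx² +
  -- α⁻¹e²`.
  have h2 : 0 ≤ α⁻¹ • (star (α • x - e) * (α • x - e)) :=
    smul_nonneg (by positivity) (star_mul_self_nonneg _)
  have h3 : α⁻¹ • (e * e) ≤ α⁻¹ • e :=
    smul_le_smul_of_nonneg_left (mul_self_le_self_of_norm_le_one he he1) (by positivity)
  have h4 : α⁻¹ • (star (α • x - e) * (α • x - e))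
      = α • (x * x) - x * e - e * x + α⁻¹ • (e * e) := by
    rw [star_sub, star_smul, hxs.star_eq, hes.star_eq]
    simp only [star_trivial, mul_sub, sub_mul, smul_mul_assoc, mul_smul_comm, smul_sub, smul_smul]
    rw [inv_mul_cancel_left₀ hα.ne', inv_mul_cancel₀ hα.ne']
    simp only [one_smul]
    abel
  rw [h4] at h2
  rw [← sub_nonneg]
  have h5 := add_nonneg (add_nonneg h1 h2) (sub_nonneg.2 h3)
  refine h5.trans_eq ?_
  abel

namespace QuasitraceOn

variable {D : NonUnitalStarSubalgebra ℂ A} {T : A → ℝ}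

/-- Comparison of `T x` with the value of `T` at the image of an approximation `m` of
`(1 - e) x (1 - e)`, if `e` is approximately dominated by an element with small support. -/
theorem abs_sub_le_of_approx (hT : QuasitraceOn D T) {C : ℝ}
    (hC : ∀ x ∈ D, 0 ≤ x → T x ≤ C * ‖x‖) (hC0 : 0 ≤ C) {x e s g ξ m ω : A} {δ α : ℝ}
    (hx : x ∈ D) (hx0 : 0 ≤ x) (he : 0 ≤ e) (he1 : ‖e‖ ≤ 1) (hs : 0 ≤ s) (hg : g ∈ D) (hg0 : 0 ≤ g)
    (hgs : g * s = s) (hδ : 0 < δ) (hα : 0 < α) (hαx : α * ‖x‖ ^ 2 ≤ δ / 4)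
    (hξ : ‖star ξ * s * ξ - e‖ ≤ α * (δ / 4)) (hm : 0 ≤ m)
    (hmx : ‖m - (x - e * x - x * e + e * x * e)‖ ≤ δ / 2) (hω : ω * m * star ω ∈ D)
    (hωm : star ω * ω * m = m) :
    |T x - T (ω * m * star ω)| ≤ C * (4 * δ) + (‖x‖ + δ) * T g := by
  set Q := x - e * x - x * e + e * x * e with hQ
  have hxs := IsSelfAdjoint.of_nonneg hx0
  have hes := IsSelfAdjoint.of_nonneg he
  have hms := IsSelfAdjoint.of_nonneg hm
  have hss := IsSelfAdjoint.of_nonneg hs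
  have hQ0 : 0 ≤ Q := sub_mul_sub_nonneg hx0 hes
  have hQs := IsSelfAdjoint.of_nonneg hQ0
  have hTg := hT.nonneg hg hg0
  set r := cfcₙ Real.sqrt x with hr
  have hrs : IsSelfAdjoint r := isSelfAdjoint_cfcₙ _ x
  have hrr : r * r = x := cfcₙ_sqrt_mul_self hx0
  have hrD : r ∈ D := hT.cfcₙ_mem _ hx
  set q := cfcₙ Real.sqrt m with hq
  have hqs : IsSelfAdjoint q := isSelfAdjoint_cfcₙ _ m
  have hqq : q * q = m := cfcₙ_sqrt_mul_self hm
  have hωq : star ω * ω * q = q :=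
    mul_cfcₙ_sqrt_eq_of_mul_eq (IsSelfAdjoint.star_mul_self ω) hm hωm
  have hv1 : ω * q * star (ω * q) = ω * m * star ω := by
    rw [star_mul, hqs.star_eq, ← hqq]
    simp only [mul_assoc]
  have hv2 : star (ω * q) * (ω * q) = m := by
    rw [star_mul, hqs.star_eq, ← hqq]
    conv_rhs => rw [← hωq]
    rw [hωq]
    calc q * star ω * (ω * q) = q * (star ω * ω * q) := by simp only [mul_assoc]
      _ = q * q := by rw [hωq]
  have hu1 : r * star r = x := by rw [hrs.star_eq, hrr]
  have hu2 : star r * r = x := by rw [hrs.star_eq, hrr]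
  rw [abs_le]
  constructor
  · have h0 : 0 ≤ (‖x‖ + δ) * T g := by positivity
    -- `y⋆y = (1-e)x(1-e)` is within `δ/2` of `m`, whereas `yy⋆ ≤ x`; the tracial comparison passes
    -- from one to the other.
    set y := r - r * e with hy
    have hy1 : star y * y = Q := by
      rw [hy, star_sub, star_mul, hrs.star_eq, hes.star_eq, hQ, ← hrr]
      noncomm_ring
    have hy2 : y * star y = x - r * (e + (e - e * e)) * r := by
      rw [hy, star_sub, star_mul, hrs.star_eq, hes.star_eq, ← hrr]
      noncomm_ring
    have hyD : y * star y ∈ D := by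
      rw [hy2]
      exact sub_mem hx (hT.mul_mul_mem _ hrD _ _ hrD)
    have hyx : y * star y ≤ x := by
      rw [hy2, sub_le_self_iff]
      have := star_left_conjugate_nonneg
        (add_nonneg he (sub_nonneg.2 (mul_self_le_self_of_norm_le_one he he1))) r
      rwa [hrs.star_eq] at this
    have h1 := hT.le_add_of_conjugate_le_of_bound hC hC0 (u := ω * q) (v := y) (w := 0) (h := 0)
      (ε := δ / 2) (δ := δ) (by rwa [hv1]) hyD (zero_mem D) le_rfl (by simp) (by linarith) hδ
      (fun k => by
        rw [hv2, hy1]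
        have h2 := conjugate_le_of_norm_le (hms.sub hQs) hmx k
        rw [mul_sub, sub_mul] at h2
        simpa [add_comm] using sub_le_iff_le_add.1 h2)
    have h2 := hT.mono hyD hx (mul_star_self_nonneg y) hyx
    rw [hv1, hT.map_zero, mul_zero, add_zero] at h1
    linarith
  · set t := cfcₙ Real.sqrt s with ht
    have hts : IsSelfAdjoint t := isSelfAdjoint_cfcₙ _ s
    have htt : t * t = s := cfcₙ_sqrt_mul_self hs
    have hgt : g * t = t := mul_cfcₙ_sqrt_eq_of_mul_eq (IsSelfAdjoint.of_nonneg hg0) hs hgs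
    -- `w⋆w = α⁻¹ ξ⋆sξ` replaces the term `α⁻¹e`, and `g` is a left unit for `w`. The errors `δ/2`
    -- from `m`, `δ/4` from `αx²` and `δ/4` from `e` add up to `δ`.
    set w := √α⁻¹ • (t * ξ) with hw
    have hww : star w * w = α⁻¹ • (star ξ * s * ξ) := by
      rw [hw, star_smul, star_mul, hts.star_eq, ← htt]
      simp only [star_trivial, smul_mul_assoc, mul_smul_comm, smul_smul,
        Real.mul_self_sqrt (inv_nonneg.2 hα.le), mul_assoc]
    have hxx : ‖α • (x * x)‖ ≤ δ / 4 := by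
      rw [norm_smul, Real.norm_of_nonneg hα.le]
      refine le_trans ?_ hαx
      have := norm_mul_le x x
      rw [pow_two]
      gcongr
    have hee : ‖α⁻¹ • (e - star ξ * s * ξ)‖ ≤ δ / 4 := by
      rw [norm_smul, Real.norm_of_nonneg (inv_nonneg.2 hα.le), norm_sub_rev, inv_mul_le_iff₀ hα]
      exact hξ
    have hξs : IsSelfAdjoint (star ξ * s * ξ) := by
      rw [IsSelfAdjoint, star_mul, star_mul, star_star, hss.star_eq, mul_assoc]
    have h1 := hT.le_add_of_conjugate_le_of_bound hC hC0 (u := r) (v := ω * q) (w := w) (h := g)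
      (ε := δ) (δ := δ) (by rwa [hu1]) (by rwa [hv1]) hg hg0
      (by rw [hw, mul_smul_comm, ← mul_assoc, hgt]) le_rfl hδ
      (fun k => by
        rw [hu2, hv2, hww]
        have k1 := star_left_conjugate_le_conjugate (le_one_sub_conjugate_add hx0 he he1 hα) k
        have k2 := conjugate_le_of_norm_le (d := Q - m) (M := δ / 2) (hQs.sub hms)
          (by rwa [norm_sub_rev]) k
        have k3 := conjugate_le_of_norm_le
          ((IsSelfAdjoint.all α).smul (by rw [IsSelfAdjoint, star_mul, hxs.star_eq])) hxx k
        have k4 := conjugate_le_of_norm_le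
          ((IsSelfAdjoint.all α⁻¹).smul (hes.sub hξs)) hee k
        rw [← hQ] at k1
        have k5 := add_le_add (add_le_add (add_le_add k1 k2) k3) k4
        have eL : Q + α • (x * x) + α⁻¹ • e
          = m + α⁻¹ • (star ξ * s * ξ) + (Q - m) + α • (x * x)
            + α⁻¹ • (e - star ξ * s * ξ) := by
          rw [smul_sub]
          abel
        rw [eL] at k5
        rw [← sub_nonneg] at k5 ⊢
        refine k5.trans_eq ?_
        simp only [mul_add, add_mul]
        module)
    rw [hu1, hv1] at h1
    linarith

end QuasitraceOn

end Approximation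

end CStarTracial

/-! ### Cut-downs of the approximants and the conjugating element -/

namespace CStarTracial

section Approximation

variable {A : Type u} [NonUnitalCStarAlgebra A] [PartialOrder A] [StarOrderedRing A]

theorem norm_mul_star_self_sub_le (u v : A) :
    ‖u * star u - v * star v‖ ≤ ‖u - v‖ * (‖u‖ + ‖v‖) := by
  have e : u * star u - v * star v = (u - v) * star u + v * star (u - v) := by
    rw [star_sub]
    noncomm_ring
  rw [e, mul_add]
  refine (norm_add_le _ _).trans (add_le_add ?_ ?_)
  · exact (norm_mul_le _ _).trans_eq (by rw [norm_star])
  · exact (norm_mul_le _ _).trans_eq (by rw [norm_star, mul_comm])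

/-- The cut-off function equals `1` above `6η`, so `t(1 - f t)² ≤ 6η = ν²` and cutting moves `b` by
at most `ν`. -/
theorem norm_cut_sub_le {b c : A} (hc : 0 ≤ c) (hb : b * star b ≤ c) {R ν η : ℝ} (hR : ‖b‖ ≤ R)
    (hν : 0 ≤ ν) (hη : 0 < η) (hνη : ν ^ 2 = 6 * η) {d : A}
    (hd : d = cfcₙ (fun t => ramp (2 * η) (4 * η) t / (2 * η)) c) :
    ‖d * (b * star b) * d - b * star b‖ ≤ ν * (2 * R) := by
  have hη2 : (0 : ℝ) ≤ 2 * η := by positivity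
  let f : ℝ → ℝ := fun t => ramp (2 * η) (4 * η) t / (2 * η)
  have hf : Continuous f := (continuous_ramp _ _).div_const _
  have hf0 : f 0 = 0 := by
    simp [f, ramp_of_le hη2 (show (0 : ℝ) ≤ 4 * η by positivity)]
  have hfn : ∀ t, 0 ≤ f t := fun t => div_nonneg (ramp_nonneg hη2 _ _) hη2
  have hf1 : ∀ t, f t ≤ 1 := fun t => div_le_one_of_le₀ (ramp_le _ _ _) hη2
  have hds : IsSelfAdjoint d := hd ▸ isSelfAdjoint_cfcₙ f c
  have hd1 : ‖d‖ ≤ 1 := by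
    rw [hd]
    refine norm_cfcₙ_le_of_nonneg hc fun t _ => ?_
    rw [abs_of_nonneg (hfn t)]
    exact hf1 t
  have h1 : ‖b - d * b‖ ^ 2 ≤ ν ^ 2 := by
    rw [hd]
    refine norm_sub_cfcₙ_mul_sq_le hf hf0 hc hb fun t ht => ?_
    rw [hνη]
    rcases le_total t (6 * η) with h | h
    · have := hfn t
      have := hf1 t
      have : (1 - f t) ^ 2 ≤ 1 := by nlinarith
      nlinarith
    · have : f t = 1 := by
        simp only [f]
        rw [ramp_of_ge (by linarith), div_self (by positivity)]
      rw [this]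
      have h0 : t * (1 - 1) ^ 2 = 0 := by ring
      rw [h0]
      positivity
  have h2 : ‖b - d * b‖ ≤ ν := (abs_le_of_sq_le_sq' h1 hν).2
  have h3 : ‖d * b‖ ≤ R :=
    (norm_mul_le _ _).trans ((mul_le_of_le_one_left (norm_nonneg b) hd1).trans hR)
  have h4 := norm_mul_star_self_sub_le (d * b) b
  rw [star_mul, hds.star_eq, norm_sub_rev (d * b)] at h4
  have e1 : d * b * (star b * d) = d * (b * star b) * d := by simp only [mul_assoc]
  rw [e1] at h4
  refine h4.trans ?_
  gcongr
  linarith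

theorem norm_mul_star_sub_conjugate_le {r b e : A} (he : IsSelfAdjoint e) (he1 : ‖e‖ ≤ 1)
    {ε R : ℝ} (hε1 : ε ≤ 1) (hb : ‖r - e * r - b‖ ≤ ε) (hR : 2 * ‖r‖ + 1 ≤ R) :
    ‖b‖ ≤ R ∧ ‖b * star b - (r * star r - e * (r * star r) - r * star r * e
      + e * (r * star r) * e)‖ ≤ ε * (2 * R) := by
  have h1 : ‖r - e * r‖ ≤ 2 * ‖r‖ := by
    have h2 := (norm_mul_le e r).trans (mul_le_of_le_one_left (norm_nonneg r) he1)
    have h3 := norm_sub_le r (e * r)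
    linarith
  have h2 : ‖b‖ ≤ R := by
    have h3 := norm_sub_norm_le b (r - e * r)
    rw [norm_sub_rev b] at h3
    linarith
  refine ⟨h2, ?_⟩
  have e1 : r * star r - e * (r * star r) - r * star r * e + e * (r * star r) * e
      = (r - e * r) * star (r - e * r) := by
    rw [star_sub, star_mul, he.star_eq]
    noncomm_ring
  rw [e1]
  refine (norm_mul_star_self_sub_le _ _).trans ?_
  rw [norm_sub_rev b]
  gcongr
  · exact (norm_nonneg _).trans hb
  · linarith

/-- Where `c ≥ 2η`, an `η`-perturbation loses at most half: `2η f(c) ≤ kck ≤ k p⋆p k + η f(c)` for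
`k = √f(c)`. So `f(c)` is dominated by `η⁻¹ k p⋆p k` and factors through limits of `p bₙ`. That form
is what later forces `ωAω⋆` into `D`. -/
theorem exists_star_mul_self_eq_of_norm_sub_le {c p : A} (hc : 0 ≤ c) {η : ℝ} (hη : 0 < η)
    (h : ‖c - star p * p‖ ≤ η) :
    ∃ (b : ℕ → A) (ω : A), Tendsto (fun n => p * b n) atTop (𝓝 ω) ∧
      star ω * ω = cfcₙ (fun t => ramp (2 * η) (2 * η) t / (2 * η)) c := by
  have hη2 : (0 : ℝ) ≤ 2 * η := by positivity
  let f : ℝ → ℝ := fun t => ramp (2 * η) (2 * η) t / (2 * η)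
  have hf : Continuous f := (continuous_ramp _ _).div_const _
  have hf0 : f 0 = 0 := by simp [f, ramp_of_le hη2 hη2]
  have hfn : ∀ t, 0 ≤ f t := fun t => div_nonneg (ramp_nonneg hη2 _ _) hη2
  have hsf : Continuous fun t => √(f t) := by fun_prop
  have hsf0 : √(f 0) = 0 := by simp [hf0]
  have hcs := IsSelfAdjoint.of_nonneg hc
  set k := cfcₙ (fun t => √(f t)) c with hk
  have hks : IsSelfAdjoint k := isSelfAdjoint_cfcₙ _ c
  have hkk : star k * k = cfcₙ f c := by
    rw [hks.star_eq, hk, cfcₙ_mul_cfcₙ hsf hsf0 hsf hsf0]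
    congr 1
    ext t
    exact Real.mul_self_sqrt (hfn t)
  have h1 : (2 * η) • cfcₙ f c ≤ star k * c * k := by
    have hc1 : Continuous fun t => √(f t) * t := by fun_prop
    rw [hks.star_eq, hk, cfcₙ_mul_self hsf hsf0 hcs, cfcₙ_mul_cfcₙ hc1 (by simp) hsf hsf0,
      ← cfcₙ_smul _ _ _ hf.continuousOn hf0]
    refine cfcₙ_le_cfcₙ_of_nonneg (f := fun t => (2 * η) • f t) (by fun_prop) (by simp [hf0])
      (by fun_prop) (by simp) hc fun t _ => ?_
    rw [mul_right_comm, Real.mul_self_sqrt (hfn t), smul_eq_mul, mul_comm]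
    rcases le_total t (2 * η) with ht | ht
    · simp [f, ramp_of_le hη2 ht]
    · exact mul_le_mul_of_nonneg_left ht (hfn t)
  have h2 := conjugate_le_of_norm_le (hcs.sub (IsSelfAdjoint.star_mul_self p)) h k
  have h3 : cfcₙ f c ≤ star (√η⁻¹ • (p * k)) * (√η⁻¹ • (p * k)) + star 0 * 0 := by
    have e1 : star (√η⁻¹ • (p * k)) * (√η⁻¹ • (p * k)) = η⁻¹ • (star k * (star p * p) * k) := by
      rw [star_smul, star_mul]
      simp only [star_trivial, smul_mul_assoc, mul_smul_comm, smul_smul,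
        Real.mul_self_sqrt (inv_nonneg.2 hη.le), mul_assoc]
    have e2 : η • cfcₙ f c ≤ star k * (star p * p) * k := by
      rw [hkk, mul_sub, sub_mul] at h2
      rw [← sub_nonneg] at h1 h2 ⊢
      refine (add_nonneg h1 h2).trans_eq ?_
      module
    have e3 := smul_le_smul_of_nonneg_left e2 (inv_nonneg.2 hη.le)
    rw [smul_smul, inv_mul_cancel₀ hη.ne', one_smul] at e3
    rw [star_zero, zero_mul, add_zero, e1]
    exact e3
  obtain ⟨b, ω, y₂, hω, hy₂, heq⟩ := exists_tendsto_star_mul_add_eq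
    (cfcₙ_nonneg_of_nonneg hc fun t _ => hfn t) h3
  refine ⟨fun n => √η⁻¹ • (k * b n * cfcₙ Real.sqrt (cfcₙ f c)), ω, ?_, ?_⟩
  · simpa only [smul_mul_assoc, mul_smul_comm, mul_assoc] using hω
  · have : y₂ = 0 := tendsto_nhds_unique hy₂ (by simp)
    simpa [this] using heq

end Approximation

/-! ### Additivity imported from the approximating subalgebra -/

section Trace

variable {A : Type u} [NonUnitalCStarAlgebra A]

theorem InClassT.reExtend_conj_add {a : A} {ha : IsSelfAdjoint a}
    {τ : her a ha → ℂ} (hτ : IsTwoQuasitrace τ) {B : NonUnitalStarSubalgebra ℂ A}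
    [IsClosed (B : Set A)] (hB : InClassT B) {c : B} (hc : IsPos c) (hcP : c ∈ Ped B) {ω : A}
    (hω : ∀ x : A, ω * x * star ω ∈ her a ha) (hωc : star ω * ω * (c : A) = c) (u v : B) :
    reExtend (her a ha) τ (ω * (c * u * c + c * v * c : A) * star ω)
      = reExtend (her a ha) τ (ω * (c * u * c : A) * star ω)
        + reExtend (her a ha) τ (ω * (c * v * c : A) * star ω) := by
  -- The class condition concerns nonzero elements only; for `c = 0` all terms vanish.
  by_cases h0 : c = 0
  · have hz : reExtend (her a ha) τ 0 = 0 := by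
      let _ : PartialOrder A := CStarAlgebra.spectralOrder A
      have : StarOrderedRing A := CStarAlgebra.spectralOrderedRing A
      exact (hτ.quasitraceOn fun x hx b y hy => mul_mul_mem_her hx b hy).map_zero
    simp [h0, hz]
  · have htr := hB c hc hcP h0 _ (hτ.comp (conjHom (hc := hc.isSelfAdjoint) hω hωc))
    have hmem : ∀ z : B, c * z * c ∈ her c hc.isSelfAdjoint := fun z =>
      corner_le_her c hc.isSelfAdjoint ⟨z, rfl⟩
    have h := htr.linear.map_add ⟨_, hmem u⟩ ⟨_, hmem v⟩
    have hval : ∀ z : her c hc.isSelfAdjoint, (τ (conjHom hω hωc z)).re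
        = reExtend (her a ha) τ (ω * ((z : B) : A) * star ω) := fun z =>
      (reExtend_coe τ (conjHom hω hωc z)).symm
    have h' := congrArg Complex.re h
    rw [Complex.add_re, hval, hval, hval] at h'
    exact h'

/-- Since `f` vanishes near zero, `d` is a generator of the Pedersen ideal of `B`; the functional
calculus of `b₁b₁⋆ + b₂b₂⋆` is the same in `B` and in `A`. -/
theorem InClassT.reExtend_conj_add_of_mem {a : A} {ha : IsSelfAdjoint a}
    {τ : her a ha → ℂ} (hτ : IsTwoQuasitrace τ) {B : NonUnitalStarSubalgebra ℂ A}
    [IsClosed (B : Set A)] (hB : InClassT B) {b₁ b₂ : A} (hb₁ : b₁ ∈ B) (hb₂ : b₂ ∈ B)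
    {f : ℝ → ℝ} (hf : Continuous f) (hfn : ∀ t, 0 ≤ f t) {δ : ℝ} (hδ : 0 < δ)
    (hfδ : ∀ t ≤ δ, f t = 0) {d : A} (hd : d = cfcₙ f (b₁ * star b₁ + b₂ * star b₂)) {ω : A}
    (hω : ∀ x : A, ω * x * star ω ∈ her a ha) (hωd : star ω * ω * d = d) :
    reExtend (her a ha) τ (ω * (d * (b₁ * star b₁) * d + d * (b₂ * star b₂) * d) * star ω)
      = reExtend (her a ha) τ (ω * (d * (b₁ * star b₁) * d) * star ω)
        + reExtend (her a ha) τ (ω * (d * (b₂ * star b₂) * d) * star ω) := by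
  let _ : PartialOrder B := CStarAlgebra.spectralOrder B
  have : StarOrderedRing B := CStarAlgebra.spectralOrderedRing B
  let x : B := ⟨b₁, hb₁⟩
  let y : B := ⟨b₂, hb₂⟩
  let z : B := x * star x + y * star y
  have hz : IsPos z := CStarAlgebra.nonneg_iff_eq_star_mul_self.1
    (add_nonneg (mul_star_self_nonneg x) (mul_star_self_nonneg y))
  have hcoe : ((cfcₙ f z : B) : A) = d := by
    rw [hd]
    refine NonUnitalStarAlgHomClass.map_cfcₙ (R := ℝ) (S := ℂ)
      (NonUnitalStarSubalgebraClass.subtype B) f z hf.continuousOn (hfδ 0 hδ.le)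
      continuous_subtype_val hz.isSelfAdjoint ?_
    exact (IsSelfAdjoint.mul_star_self b₁).add (IsSelfAdjoint.mul_star_self b₂)
  have hdB : IsPos (cfcₙ f z) :=
    CStarAlgebra.nonneg_iff_eq_star_mul_self.1 (cfcₙ_nonneg fun t _ => hfn t)
  have hdP : cfcₙ f z ∈ Ped B :=
    TwoSidedIdeal.subset_span ⟨_, hz, f, hf, hfn, ⟨δ, hδ, hfδ⟩, rfl⟩
  have h1 := InClassT.reExtend_conj_add hτ hB hdB hdP hω (by rw [hcoe, hωd]) (x * star x)
    (y * star y)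
  rwa [hcoe] at h1

end Trace

/-! ### Additivity when `T` takes small values on local units -/

section Main

variable {A : Type u} [NonUnitalCStarAlgebra A] [PartialOrder A] [StarOrderedRing A]

set_option maxHeartbeats 800000 in
theorem IsTwoQuasitrace.reExtend_add_of_small {a : A} {ha : IsSelfAdjoint a}
    {τ : her a ha → ℂ} (hτ : IsTwoQuasitrace τ)
    (hA : EssentiallyTraciallyIn A (fun (B : Type u) [NonUnitalCStarAlgebra B] => InClassT B))
    (hsmall : ∀ η > 0, ∃ g ∈ her a ha, ∃ s : A, 0 ≤ g ∧ 0 ≤ s ∧ s ≠ 0 ∧ g * s = s ∧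
      reExtend (her a ha) τ g ≤ η) {x y : A} (hx : x ∈ her a ha) (hy : y ∈ her a ha)
    (hx0 : 0 ≤ x) (hy0 : 0 ≤ y) :
    reExtend (her a ha) τ (x + y) = reExtend (her a ha) τ x + reExtend (her a ha) τ y := by
  classical
  set T := reExtend (her a ha) τ
  have hT : QuasitraceOn (her a ha) T :=
    hτ.quasitraceOn fun x hx b y hy => mul_mul_mem_her hx b hy
  obtain ⟨C, hC0, hC⟩ := hT.exists_bound
  set z := x + y with hz
  have hzD : z ∈ her a ha := add_mem hx hy
  have hz0 : 0 ≤ z := add_nonneg hx0 hy0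
  set S := ‖x‖ + ‖y‖ with hS
  have hS0 : 0 ≤ S := by positivity
  set rx := cfcₙ Real.sqrt x with hrx
  set ry := cfcₙ Real.sqrt y with hry
  set rz := cfcₙ Real.sqrt z with hrz
  have hrxx : rx * star rx = x := cfcₙ_sqrt_mul_star hx0
  have hryy : ry * star ry = y := cfcₙ_sqrt_mul_star hy0
  set R := 2 * ‖rx‖ + 2 * ‖ry‖ + 1 with hR
  have hR1 : 1 ≤ R := by
    have := norm_nonneg rx
    have := norm_nonneg ry
    linarith
  have hdelta : ∀ δ : ℝ, 0 < δ → δ ≤ 1 → |T z - (T x + T y)|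
      ≤ (12 * C + 3 * (S + 1)) * δ := by
    intro δ hδ hδ1
    obtain ⟨g, hg, s, hg0, hs0, hsne, hgs, hTg⟩ := hsmall δ hδ
    -- The constants are fixed backwards: cutting by `d` costs `2Rν`, approximating `(1-e)x(1-e)` by
    -- `bb⋆` costs `2Rε = η/2 ≤ ν`, and together these are at most `ν(2R+1) = δ/4`.
    set ν := δ / (4 * (2 * R + 1)) with hν
    have hν0 : 0 < ν := by positivity
    have hν1 : ν ≤ 1 := by
      rw [hν, div_le_one (by positivity)]
      linarith
    have hνR : ν * (2 * R + 1) = δ / 4 := by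
      rw [hν]
      field_simp
    set η := ν ^ 2 / 6 with hη
    have hη0 : 0 < η := by positivity
    have hην : η ≤ ν := by nlinarith
    set ε := η / (4 * R) with hε
    have hε0 : 0 < ε := by positivity
    have hεR : ε * (2 * R) = η / 2 := by
      rw [hε]
      field_simp
      norm_num
    have hε1 : ε ≤ 1 := by nlinarith
    -- The approximation is applied to square roots, so that `bb⋆` is a positive element of `B` near
    -- `(1-e)x(1-e)`.
    obtain ⟨e, he, he1, B, hBc, -, hB, -, happ, ξs, hξs⟩ :=
      hA {rx, ry} ε hε0 s (isPos_iff_nonneg.2 hs0) hsne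
    replace he : 0 ≤ e := isPos_iff_nonneg.1 he
    have hes := IsSelfAdjoint.of_nonneg he
    obtain ⟨⟨bx, hbxB, hbx⟩, -⟩ := happ rx (by simp)
    obtain ⟨⟨yB, hbyB, hby⟩, -⟩ := happ ry (by simp)
    -- Makes `α‖·‖² ≤ δ/4` for `x`, `y` and `x + y` at once; `ξ` is then chosen with an error small
    -- relative to `α`.
    set α := δ / (4 * (S ^ 2 + 1)) with hα
    have hα0 : 0 < α := by positivity
    have hαS : ∀ t : ℝ, 0 ≤ t → t ≤ S → α * t ^ 2 ≤ δ / 4 := by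
      intro t ht0 ht
      have : t ^ 2 ≤ S ^ 2 + 1 := by nlinarith
      calc α * t ^ 2 ≤ α * (S ^ 2 + 1) := by gcongr
        _ = δ / 4 := by rw [hα]; field_simp
    obtain ⟨ξ, hξ⟩ : ∃ ξ : A, ‖star ξ * s * ξ - e‖ ≤ α * (δ / 4) := by
      have h1 := (tendsto_iff_norm_sub_tendsto_zero.1 hξs).eventually_lt_const
        (show (0 : ℝ) < α * (δ / 4) by positivity)
      obtain ⟨i, hi⟩ := h1.exists
      exact ⟨ξs i, hi.le⟩
    let Q : A → A := fun x => x - e * x - x * e + e * x * e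
    have hQadd : Q x + Q y = Q z := by
      simp only [Q, hz]
      noncomm_ring
    obtain ⟨hbxR, hbxQ⟩ := norm_mul_star_sub_conjugate_le hes he1 hε1 hbx.le
      (R := R) (by have := norm_nonneg ry; linarith)
    obtain ⟨hbyR, hbyQ⟩ := norm_mul_star_sub_conjugate_le hes he1 hε1 hby.le
      (R := R) (by have := norm_nonneg rx; linarith)
    rw [hrxx, hεR] at hbxQ
    rw [hryy, hεR] at hbyQ
    change ‖_ - Q x‖ ≤ _ at hbxQ
    change ‖_ - Q y‖ ≤ _ at hbyQ
    set X := bx * star bx with hX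
    set Y := yB * star yB with hY
    set c := X + Y with hc
    have hX0 : 0 ≤ X := mul_star_self_nonneg bx
    have hY0 : 0 ≤ Y := mul_star_self_nonneg yB
    have hc0 : 0 ≤ c := add_nonneg hX0 hY0
    have hcs := IsSelfAdjoint.of_nonneg hc0
    -- `p⋆p = (1-e)z(1-e)` is within `η` of `c`, and `p` begins with `rz ∈ D`; hence `ωAω⋆ ⊆ D` in
    -- the limit.
    set p := rz - rz * e with hp
    have hrzs : IsSelfAdjoint rz := isSelfAdjoint_cfcₙ _ z
    have hrzD : rz ∈ her a ha := hT.cfcₙ_mem _ hzD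
    have hpp : star p * p = Q z := by
      have h1 : rz * rz = z := cfcₙ_sqrt_mul_self hz0
      rw [hp, star_sub, star_mul, hrzs.star_eq, hes.star_eq]
      simp only [Q]
      rw [← h1]
      noncomm_ring
    have hcQ : ‖c - star p * p‖ ≤ η := by
      have h1 : c - star p * p = (X - Q x) + (Y - Q y) := by
        rw [hpp, ← hQadd, hc]
        abel
      rw [h1]
      refine (norm_add_le _ _).trans ?_
      linarith
    obtain ⟨b, ω, hωlim, hωω⟩ := exists_star_mul_self_eq_of_norm_sub_le hc0 hη0 hcQ
    have hωD : ∀ w : A, ω * w * star ω ∈ her a ha := by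
      intro w
      have h1 : Tendsto (fun n => p * b n * w * star (p * b n)) atTop (𝓝 (ω * w * star ω)) :=
        (hωlim.mul_const w).mul hωlim.star
      refine hT.isClosed.mem_of_tendsto h1 (Eventually.of_forall fun n => ?_)
      have h2 : p * b n * w * star (p * b n)
          = rz * ((b n - e * b n) * w * (star (b n) - star (b n) * e)) * rz := by
        rw [hp, star_mul, star_sub, star_mul, hrzs.star_eq, hes.star_eq]
        noncomm_ring
      change p * b n * w * star (p * b n) ∈ her a ha
      rw [h2]
      exact mul_mul_mem_her hrzD _ hrzD
    have hη2 : (0 : ℝ) ≤ 2 * η := by positivity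
    -- `ω⋆ω = h(c)`, and `h = 1` on `[4η, ∞)`, where `f` is supported; so `ω⋆ω` is a unit for `d =
    -- f(c)`.
    let h : ℝ → ℝ := fun t => ramp (2 * η) (2 * η) t / (2 * η)
    let f : ℝ → ℝ := fun t => ramp (2 * η) (4 * η) t / (2 * η)
    have hh : Continuous h := (continuous_ramp _ _).div_const _
    have hh0 : h 0 = 0 := by simp [h, ramp_of_le hη2 hη2]
    have hf : Continuous f := (continuous_ramp _ _).div_const _
    have hfv : ∀ t ≤ 4 * η, f t = 0 := fun t ht => by simp [f, ramp_of_le hη2 ht]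
    have hf0 : f 0 = 0 := hfv 0 (by positivity)
    have hfn : ∀ t, 0 ≤ f t := fun t => div_nonneg (ramp_nonneg hη2 _ _) hη2
    have hhf : ∀ t, h t * f t = f t := by
      intro t
      rcases le_total t (4 * η) with ht | ht
      · simp [hfv t ht]
      · have : h t = 1 := by
          simp only [h]
          rw [ramp_of_ge (by linarith), div_self (by positivity)]
        rw [this, one_mul]
    set d := cfcₙ f c with hd
    have hds : IsSelfAdjoint d := isSelfAdjoint_cfcₙ f c
    have hωd : star ω * ω * d = d := by
      rw [hωω, hd, cfcₙ_mul_cfcₙ hh hh0 hf hf0]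
      simp only [hhf]
    have hcut : ∀ {b x : A}, b * star b ≤ c → ‖b‖ ≤ R → ‖b * star b - Q x‖ ≤ η / 2 →
        ‖d * (b * star b) * d - Q x‖ ≤ δ / 4 := by
      intro b x hbc hbR hbQ
      have h5 := norm_cut_sub_le hc0 hbc hbR hν0.le hη0 (by rw [hη]; ring) hd
      have h6 := norm_sub_le_norm_sub_add_norm_sub (d * (b * star b) * d) (b * star b) (Q x)
      linarith
    have hXX := hcut (x := x) (le_add_of_nonneg_right hY0) hbxR hbxQ
    have hYY := hcut (x := y) (le_add_of_nonneg_left hX0) hbyR hbyQ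
    have hdXd : ∀ X : A, 0 ≤ X → 0 ≤ d * X * d := fun X hX => by
      have := star_left_conjugate_nonneg hX d
      rwa [hds.star_eq] at this
    have hωdX : ∀ X : A, star ω * ω * (d * X * d) = d * X * d := fun X => by
      rw [← mul_assoc, ← mul_assoc, hωd]
    have hTg0 := hT.nonneg hg hg0
    have hcomp : ∀ {x m : A}, x ∈ her a ha → 0 ≤ x → ‖x‖ ≤ S → 0 ≤ m → star ω * ω * m = m →
        ‖m - Q x‖ ≤ δ / 2 → |T x - T (ω * m * star ω)| ≤ (4 * C + (S + 1)) * δ := by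
      intro x m hx hx0 hxS hm hωm hmQ
      refine (hT.abs_sub_le_of_approx hC hC0 hx hx0 he he1 hs0 hg hg0 hgs hδ hα0
        (hαS _ (norm_nonneg x) hxS) hξ hm hmQ (hωD m) hωm).trans ?_
      have : (‖x‖ + δ) * T g ≤ (S + 1) * δ := by gcongr
      linarith
    have kx := hcomp hx hx0 (le_add_of_nonneg_right (norm_nonneg y)) (hdXd X hX0) (hωdX X)
      (by linarith)
    have ky := hcomp hy hy0 (le_add_of_nonneg_left (norm_nonneg x)) (hdXd Y hY0) (hωdX Y)
      (by linarith)
    have kz := hcomp (m := d * X * d + d * Y * d) hzD hz0 (norm_add_le x y)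
      (add_nonneg (hdXd X hX0) (hdXd Y hY0)) (by rw [mul_add, hωdX, hωdX]) (by
        have e1 : d * X * d + d * Y * d - Q z = (d * X * d - Q x) + (d * Y * d - Q y) := by
          rw [← hQadd]
          abel
        rw [e1]
        refine (norm_add_le _ _).trans ?_
        linarith)
    have htr : T (ω * (d * X * d + d * Y * d) * star ω)
        = T (ω * (d * X * d) * star ω) + T (ω * (d * Y * d) * star ω) :=
      InClassT.reExtend_conj_add_of_mem hτ hB hbxB hbyB hf hfn (by positivity) hfv hd hωD hωd
    rw [htr] at kz
    rw [abs_le] at kx ky kz ⊢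
    constructor <;> linarith [kx.1, kx.2, ky.1, ky.2, kz.1, kz.2]
  have hK : 0 < 12 * C + 3 * (S + 1) := by positivity
  have hle : |T z - (T x + T y)| ≤ 0 := by
    refine le_of_forall_pos_le_add fun ε hε => ?_
    set K := 12 * C + 3 * (S + 1)
    have h1 := hdelta (min 1 (ε / K)) (lt_min one_pos (by positivity)) (min_le_left _ _)
    refine h1.trans ?_
    calc K * min 1 (ε / K) ≤ K * (ε / K) := by gcongr; exact min_le_right _ _
      _ = 0 + ε := by field_simp; simp
  exact sub_eq_zero.1 (abs_eq_zero.1 (le_antisymm hle (abs_nonneg _)))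

end Main

end CStarTracial

/-! ### Additivity when `T` is bounded below on local units -/

namespace CStarTracial

section Discrete

variable {A : Type u} [NonUnitalCStarAlgebra A] [PartialOrder A] [StarOrderedRing A]

/-- A continuous bump function at `i` of width `d`. -/
noncomputable def bump (d i t : ℝ) : ℝ := max 0 (min 1 (2 - 6 * |t - i| / d))

theorem continuous_bump (d i : ℝ) : Continuous (bump d i) := by
  unfold bump
  fun_prop

theorem bump_nonneg (d i t : ℝ) : 0 ≤ bump d i t := le_max_left _ _

theorem bump_le_one (d i t : ℝ) : bump d i t ≤ 1 := max_le zero_le_one (min_le_left _ _)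

theorem bump_of_le {d i t : ℝ} (hd : 0 < d) (h : d / 3 ≤ |t - i|) : bump d i t = 0 := by
  refine max_eq_left ((min_le_right _ _).trans ?_)
  rw [sub_nonpos, le_div_iff₀ hd]
  linarith

theorem bump_of_ge {d i t : ℝ} (hd : 0 < d) (h : |t - i| ≤ d / 6) : bump d i t = 1 := by
  have : 1 ≤ 2 - 6 * |t - i| / d := by
    rw [le_sub_comm, div_le_iff₀ hd]
    linarith
  rw [bump, min_eq_left this, max_eq_right zero_le_one]

/-- On a finite spectrum every function is continuous, so indicators of points give spectral
projections; the point `0` is omitted. -/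
theorem exists_cfcₙ_eq_sum_of_finite {x : A} (hx : 0 ≤ x) (hfin : (quasispectrum ℝ x).Finite) :
    ∃ S : Finset ℝ, (∀ l ∈ S, 0 < l) ∧
      (∀ l ∈ S, IsStarProjection (cfcₙ (fun t => if t = l then (1 : ℝ) else 0) x)) ∧
      (∀ l ∈ S, x * cfcₙ (fun t => if t = l then (1 : ℝ) else 0) x
        = l • cfcₙ (fun t => if t = l then (1 : ℝ) else 0) x) ∧
      x = ∑ l ∈ S, l • cfcₙ (fun t => if t = l then (1 : ℝ) else 0) x := by
  classical
  have hxs := IsSelfAdjoint.of_nonneg hx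
  have hcont : ∀ f : ℝ → ℝ, ContinuousOn f (quasispectrum ℝ x) := fun f => hfin.continuousOn f
  have hpos : ∀ l ∈ hfin.toFinset.erase 0, 0 < l := by
    intro l hl
    rw [Finset.mem_erase, Set.Finite.mem_toFinset] at hl
    exact lt_of_le_of_ne (quasispectrum_nonneg_of_nonneg x hx l hl.2) hl.1.symm
  have h0 : ∀ l ∈ hfin.toFinset.erase 0, (if (0 : ℝ) = l then (1 : ℝ) else 0) = 0 :=
    fun l hl => if_neg (hpos l hl).ne
  refine ⟨hfin.toFinset.erase 0, hpos, fun l hl => ⟨?_, isSelfAdjoint_cfcₙ _ x⟩, fun l hl => ?_, ?_⟩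
  · rw [IsIdempotentElem, ← cfcₙ_mul (fun t => if t = l then (1 : ℝ) else 0)
      (fun t => if t = l then (1 : ℝ) else 0) x
      (hcont _) (h0 l hl) (hcont _) (h0 l hl)]
    congr 1
    ext t
    split_ifs <;> simp
  · nth_rewrite 1 [← cfcₙ_id' ℝ x]
    rw [← cfcₙ_mul (fun t => t) (fun t => if t = l then (1 : ℝ) else 0) x
      (hcont _) rfl (hcont _) (h0 l hl),
      ← cfcₙ_smul l (fun t => if t = l then (1 : ℝ) else 0) x (hcont _) (h0 l hl)]
    congr 1
    ext t
    split_ifs with h <;> simp [h]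
  · have h1 : ∀ l ∈ hfin.toFinset.erase 0, l • cfcₙ (fun t => if t = l then (1 : ℝ) else 0) x
        = cfcₙ (fun t => l • if t = l then (1 : ℝ) else 0) x := fun l hl =>
      (cfcₙ_smul l (fun t => if t = l then (1 : ℝ) else 0) x (hcont _) (h0 l hl)).symm
    rw [Finset.sum_congr rfl h1, ← cfcₙ_sum (fun l t => l • if t = l then (1 : ℝ) else 0) x _
      (fun _ _ => hcont _) (fun l hl => by rw [h0 l hl, smul_zero])]
    nth_rewrite 1 [← cfcₙ_id' ℝ x]
    refine cfcₙ_congr fun t ht => ?_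
    by_cases ht0 : t = 0
    · subst ht0
      rw [Finset.sum_apply, Finset.sum_eq_zero]
      intro l hl
      rw [h0 l hl, smul_zero]
    · rw [Finset.sum_apply, Finset.sum_eq_single_of_mem t (by simp [ht0, ht])]
      · simp
      · intro l _ hl
        simp [hl.symm]

theorem exists_isStarProjection_mul_eq_of_finite {D : NonUnitalStarSubalgebra ℂ A} {T : A → ℝ}
    (hT : QuasitraceOn D T) {x : A} (hxD : x ∈ D) (hx : 0 ≤ x)
    (hfin : (quasispectrum ℝ x).Finite) : ∃ e ∈ D, IsStarProjection e ∧ e * x = x := by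
  have hcont : ∀ f : ℝ → ℝ, ContinuousOn f (quasispectrum ℝ x) := fun f => hfin.continuousOn f
  refine ⟨cfcₙ (fun t => if t = 0 then (0 : ℝ) else 1) x, hT.cfcₙ_mem _ hxD,
    ⟨?_, isSelfAdjoint_cfcₙ _ x⟩, ?_⟩
  · rw [IsIdempotentElem, ← cfcₙ_mul (fun t => if t = 0 then (0 : ℝ) else 1)
      (fun t => if t = 0 then (0 : ℝ) else 1) x
      (hcont _) (if_pos rfl) (hcont _) (if_pos rfl)]
    congr 1
    ext t
    split_ifs <;> simp
  · have hxs := IsSelfAdjoint.of_nonneg hx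
    nth_rewrite 2 [← cfcₙ_id' ℝ x]
    rw [← cfcₙ_mul (fun t => if t = 0 then (0 : ℝ) else 1) (fun t => t) x
      (hcont _) (if_pos rfl) (hcont _) rfl]
    conv_rhs => rw [← cfcₙ_id' ℝ x]
    congr 1
    ext t
    split_ifs with h <;> simp [h]

/-- A minimal projection of `D`. -/
structure IsMinimalProjection (D : NonUnitalStarSubalgebra ℂ A) (p : A) : Prop where
  mem : p ∈ D
  isStarProjection : IsStarProjection p
  ne_zero : p ≠ 0
  eq_zero_or_eq : ∀ q ∈ D, IsStarProjection q → p * q = q → q = 0 ∨ q = p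

namespace QuasitraceOn

variable {D : NonUnitalStarSubalgebra ℂ A} {T : A → ℝ} {η : ℝ}

theorem cfcₙ_sum (hT : QuasitraceOn D T) {ι : Type*} {f : ι → ℝ → ℝ} (hf : ∀ i, Continuous (f i))
    {x : A} (hx : x ∈ D) (S : Finset ι) (hf0 : ∀ i ∈ S, f i 0 = 0) :
    T (cfcₙ (fun t => ∑ i ∈ S, f i t) x) = ∑ i ∈ S, T (cfcₙ (f i) x) := by
  classical
  induction S using Finset.induction_on with
  | empty => simpa using hT.map_zero
  | insert i S hi ih =>
    simp only [Finset.sum_insert hi]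
    have hS : ∀ j ∈ S, f j 0 = 0 := fun j hj => hf0 j (Finset.mem_insert_of_mem hj)
    rw [hT.cfcₙ_add (hf i) (hf0 i (Finset.mem_insert_self i S))
      (continuous_finsetSum S fun j _ => hf j) (Finset.sum_eq_zero hS) hx, ih hS]

/-- Infinitely many spectral points would give `N + 1` disjoint bumps with `Nη > C`. Each has
`T`-value at least `η`, yet their sum has norm at most `1` and thus value at most `C`. -/
theorem finite_quasispectrum (hT : QuasitraceOn D T) (hη : 0 < η)
    (hlow : ∀ g ∈ D, ∀ s : A, 0 ≤ g → 0 ≤ s → s ≠ 0 → g * s = s → η < T g) {x : A} (hxD : x ∈ D)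
    (hx : 0 ≤ x) : (quasispectrum ℝ x).Finite := by
  classical
  by_contra hinf
  obtain ⟨C, hC0, hC⟩ := hT.exists_bound
  obtain ⟨N, hN⟩ := exists_nat_gt (C / η)
  rw [div_lt_iff₀ hη] at hN
  have hinf' : (quasispectrum ℝ x \ {0}).Infinite := Set.Infinite.sdiff hinf (Set.finite_singleton 0)
  obtain ⟨S, hS, hcard⟩ := hinf'.exists_subset_card_eq (N + 1)
  obtain ⟨d, hd, hsep⟩ : ∃ d > 0, ∀ i ∈ insert 0 S, ∀ j ∈ insert 0 S, i ≠ j → d ≤ |i - j| := by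
    refine ⟨(((insert 0 S : Finset ℝ)) : Set ℝ).infsep, ?_, fun i hi j hj hij => ?_⟩
    · rw [gt_iff_lt, Set.Finite.infsep_pos_iff_nontrivial (Finset.finite_toSet _)]
      obtain ⟨i, hi⟩ := Finset.card_pos.1 (by rw [hcard]; exact Nat.succ_pos N)
      exact ⟨0, by simp, i, by simp [hi], fun h => (hS hi).2 h.symm⟩
    · exact Set.infsep_le_dist_of_mem (Finset.mem_coe.2 hi) (Finset.mem_coe.2 hj) hij
  have hf0 : ∀ i ∈ S, bump d i 0 = 0 := fun i hi => by
    refine bump_of_le hd ?_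
    have := hsep 0 (by simp) i (by simp [hi]) fun h => (hS hi).2 h.symm
    linarith
  have hsum : ∀ t, 0 ≤ ∑ i ∈ S, bump d i t ∧ ∑ i ∈ S, bump d i t ≤ 1 := by
    intro t
    refine ⟨Finset.sum_nonneg fun i _ => bump_nonneg d i t, ?_⟩
    by_cases h : ∃ i ∈ S, |t - i| < d / 3
    · obtain ⟨i, hi, hti⟩ := h
      rw [Finset.sum_eq_single_of_mem i hi]
      · exact bump_le_one d i t
      · intro j hj hji
        refine bump_of_le hd ?_
        have h1 := hsep j (by simp [hj]) i (by simp [hi]) hji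
        have h2 := abs_sub_le j t i
        rw [abs_sub_comm j t] at h2
        linarith
    · push Not at h
      rw [Finset.sum_eq_zero fun i hi => bump_of_le hd (h i hi)]
      exact zero_le_one
  have h1 : T (cfcₙ (fun t => ∑ i ∈ S, bump d i t) x) ≤ C := by
    refine (hC _ (hT.cfcₙ_mem _ hxD) (cfcₙ_nonneg_of_nonneg hx fun t _ => (hsum t).1)).trans ?_
    refine mul_le_of_le_one_right hC0 (norm_cfcₙ_le_of_nonneg hx fun t _ => ?_)
    rw [abs_of_nonneg (hsum t).1]
    exact (hsum t).2
  rw [hT.cfcₙ_sum (fun i => continuous_bump d i) hxD S hf0] at h1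
  have h2 : ∀ i ∈ S, η ≤ T (cfcₙ (bump d i) x) := by
    intro i hi
    -- A narrower bump on whose support `bump d i` equals `1`; it is nonzero at `x` since `i` is a
    -- spectral point.
    let g : ℝ → ℝ := fun t => max 0 (1 - 6 * |t - i| / d)
    have hg : Continuous g := by fun_prop
    have hgz : ∀ t, d / 6 ≤ |t - i| → g t = 0 := fun t ht => by
      refine max_eq_left ?_
      rw [sub_nonpos, le_div_iff₀ hd]
      linarith
    have hg0 : g 0 = 0 := hgz 0 (by
      have := hsep 0 (by simp) i (by simp [hi]) fun h => (hS hi).2 h.symm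
      linarith)
    refine (hlow _ (hT.cfcₙ_mem _ hxD) (cfcₙ g x)
      (cfcₙ_nonneg_of_nonneg hx fun t _ => bump_nonneg d i t)
      (cfcₙ_nonneg_of_nonneg hx fun t _ => le_max_left _ _) ?_ ?_).le
    · intro h0
      have h3 : cfcₙ g x = cfcₙ (fun _ : ℝ => (0 : ℝ)) x := by rw [h0, cfcₙ_const_zero]
      have h4 := eqOn_of_cfcₙ_eq_cfcₙ h3 (IsSelfAdjoint.of_nonneg hx) hg.continuousOn hg0
        continuousOn_const rfl (hS hi).1
      simp [g] at h4
    · rw [cfcₙ_mul_cfcₙ (continuous_bump d i) (hf0 i hi) hg hg0]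
      congr 1
      ext t
      rcases le_total (d / 6) |t - i| with h | h
      · simp [hgz t h]
      · rw [bump_of_ge hd h, one_mul]
  have h3 := Finset.card_nsmul_le_sum S _ η h2
  rw [hcard, nsmul_eq_mul] at h3
  push_cast at h3
  linarith

/-- Every projection of `D` is a sum of minimal ones. -/
theorem projection_induction (hT : QuasitraceOn D T) (hη : 0 < η)
    (hlow : ∀ p ∈ D, IsStarProjection p → p ≠ 0 → η ≤ T p) {P : A → Prop} (zero : P 0)
    (minimal : ∀ p, IsMinimalProjection D p → P p)
    (add : ∀ p ∈ D, ∀ q ∈ D, IsStarProjection p → IsStarProjection q → p * q = 0 → q * p = 0 →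
      P p → P q → P (p + q)) {p : A} (hp : p ∈ D) (hpp : IsStarProjection p) : P p := by
  -- Induction on the value of `T` in units of `η`: splitting off a proper nonzero subprojection
  -- lowers the value of both pieces by at least `η`.
  have key : ∀ n : ℕ, ∀ p ∈ D, IsStarProjection p → T p < n * η → P p := by
    intro n
    induction n with
    | zero =>
      intro p hp hpp hlt
      have := hT.nonneg hp hpp.nonneg
      simp only [Nat.cast_zero, zero_mul] at hlt
      linarith
    | succ n ih =>
      intro p hp hpp hlt
      by_cases h0 : p = 0
      · exact h0 ▸ zero
      by_cases hmin : ∀ q ∈ D, IsStarProjection q → p * q = q → q = 0 ∨ q = p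
      · exact minimal p ⟨hp, hpp, h0, hmin⟩
      push Not at hmin
      obtain ⟨q, hq, hqq, hpq, hq0, hqp⟩ := hmin
      have hqp' : q * p = q := by
        have := congrArg star hpq
        rwa [star_mul, hqq.isSelfAdjoint.star_eq, hpp.isSelfAdjoint.star_eq] at this
      have e1 : p * p = p := hpp.isIdempotentElem
      have e2 : q * q = q := hqq.isIdempotentElem
      have hr : p - q ∈ D := sub_mem hp hq
      have hrr : IsStarProjection (p - q) := by
        refine ⟨?_, hpp.isSelfAdjoint.sub hqq.isSelfAdjoint⟩
        rw [IsIdempotentElem, mul_sub, sub_mul, sub_mul, e1, e2, hpq, hqp']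
        abel
      have hr0 : p - q ≠ 0 := fun h => hqp (sub_eq_zero.1 h).symm
      have z1 : q * (p - q) = 0 := by rw [mul_sub, hqp', e2, sub_self]
      have z2 : (p - q) * q = 0 := by rw [sub_mul, hpq, e2, sub_self]
      have hadd := hT.add_of_commute q hq (p - q) hr hqq.isSelfAdjoint hrr.isSelfAdjoint
        (z1.trans z2.symm)
      rw [add_sub_cancel] at hadd
      have l1 := hlow q hq hqq hq0
      have l2 := hlow (p - q) hr hrr hr0
      push_cast at hlt
      have := add q hq (p - q) hr hqq hrr z1 z2 (ih q hq hqq (by linarith))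
        (ih _ hr hrr (by linarith))
      rwa [add_sub_cancel] at this
  obtain ⟨n, hn⟩ := exists_nat_gt (T p / η)
  exact key n p hp hpp ((div_lt_iff₀ hη).1 hn)

/-- The spectral projections of `pyp` for nonzero points lie under `p`, so by minimality each is `0`
or `p`. -/
theorem exists_conjugate_eq_smul (hT : QuasitraceOn D T)
    (hfin : ∀ x ∈ D, 0 ≤ x → (quasispectrum ℝ x).Finite) {p : A} (hp : IsMinimalProjection D p)
    {y : A} (hy : 0 ≤ y) : ∃ r : ℝ, 0 ≤ r ∧ p * y * p = r • p := by
  have hps := hp.isStarProjection.isSelfAdjoint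
  have hpp : p * p = p := hp.isStarProjection.isIdempotentElem
  set x := p * y * p with hx
  have hxD : x ∈ D := hT.mul_mul_mem p hp.mem y p hp.mem
  have hx0 : 0 ≤ x := by
    have := star_left_conjugate_nonneg hy p
    rwa [hps.star_eq] at this
  have hpx : p * x = x := by rw [hx, ← mul_assoc, ← mul_assoc, hpp]
  obtain ⟨S, hS0, hSp, hSx, hsum⟩ := exists_cfcₙ_eq_sum_of_finite hx0 (hfin x hxD hx0)
  have h1 : ∀ l ∈ S, ∃ r : ℝ, 0 ≤ r ∧
      l • cfcₙ (fun t => if t = l then (1 : ℝ) else 0) x = r • p := by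
    intro l hl
    set q := cfcₙ (fun t => if t = l then (1 : ℝ) else 0) x
    have hq : p * q = q := by
      have h2 : l • (p * q) = l • q := by
        rw [← mul_smul_comm, ← hSx l hl, ← mul_assoc, hpx]
      exact smul_right_injective A (hS0 l hl).ne' h2
    rcases hp.eq_zero_or_eq q (hT.cfcₙ_mem _ hxD) (hSp l hl) hq with h | h
    · exact ⟨0, le_rfl, by rw [h]; simp⟩
    · exact ⟨l, (hS0 l hl).le, by rw [h]⟩
  choose! r hr0 hr using h1
  refine ⟨∑ l ∈ S, r l, Finset.sum_nonneg hr0, ?_⟩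
  rw [hsum, Finset.sum_smul]
  exact Finset.sum_congr rfl hr

theorem exists_conjugate_eq_complex_smul (hT : QuasitraceOn D T)
    (hfin : ∀ x ∈ D, 0 ≤ x → (quasispectrum ℝ x).Finite) {p : A} (hp : IsMinimalProjection D p)
    (y : A) : ∃ c : ℂ, p * y * p = c • p := by
  have hy : y ∈ Submodule.span ℂ {a : A | 0 ≤ a} := by
    rw [CStarAlgebra.span_nonneg]
    exact Submodule.mem_top
  induction hy using Submodule.span_induction with
  | mem y hy =>
    obtain ⟨r, -, hr⟩ := hT.exists_conjugate_eq_smul hfin hp hy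
    exact ⟨r, by rw [hr, Complex.coe_smul]⟩
  | zero => exact ⟨0, by simp⟩
  | add y z _ _ hy hz =>
    obtain ⟨c, hc⟩ := hy
    obtain ⟨d, hd⟩ := hz
    exact ⟨c + d, by rw [mul_add, add_mul, hc, hd, add_smul]⟩
  | smul a y _ hy =>
    obtain ⟨c, hc⟩ := hy
    exact ⟨a * c, by rw [mul_smul_comm, smul_mul_assoc, hc, smul_smul]⟩

/-- The set of `x` with `qAx = 0` is a closed two-sided ideal. It would contain `p ≠ 0`, hence be
everything, and then contain `q`, contradicting `q³ ≠ 0`. -/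
theorem _root_.CStarTracial.IsSimpleCStar.exists_mul_mul_ne_zero (hs : IsSimpleCStar A) {p q : A}
    (hp : p ≠ 0) (hqq : q * q * q ≠ 0) : ∃ y : A, q * y * p ≠ 0 := by
  by_contra! h
  let I : TwoSidedIdeal A := TwoSidedIdeal.mk' {x | ∀ a, q * a * x = 0} (by simp)
    (fun hx hy a => by rw [mul_add, hx a, hy a, add_zero])
    (fun hx a => by rw [mul_neg, hx a, neg_zero])
    (fun {x y} hy a => by rw [← mul_assoc, mul_assoc q, hy (a * x)])
    (fun {x y} hx a => by rw [← mul_assoc, hx a, zero_mul])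
  have hI : ∀ x, x ∈ I ↔ ∀ a, q * a * x = 0 := fun x => TwoSidedIdeal.mem_mk' ..
  have hcl : IsClosed (I : Set A) := by
    have : (I : Set A) = ⋂ a, {x | q * a * x = 0} := by
      ext x
      simp [hI]
    rw [this]
    exact isClosed_iInter fun a => isClosed_eq (by fun_prop) continuous_const
  rcases hs.2 I hcl with h1 | h1
  · have : p ∈ I := (hI p).2 h
    rw [h1, TwoSidedIdeal.mem_bot] at this
    exact hp this
  · have : q ∈ I := by
      rw [h1]
      exact TwoSidedIdeal.mem_top _
    exact hqq ((hI q).1 this q)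

/-- Simplicity gives `u = qyp ≠ 0`; minimality of `p` makes `u⋆u` a positive multiple of `p`, and
after normalization minimality of `q` identifies the range projection. -/
theorem exists_equivalence (hT : QuasitraceOn D T) (hs : IsSimpleCStar A)
    (hfin : ∀ x ∈ D, 0 ≤ x → (quasispectrum ℝ x).Finite) {p q : A} (hp : IsMinimalProjection D p)
    (hq : IsMinimalProjection D q) : ∃ v ∈ D, star v * v = p ∧ v * star v = q := by
  have hps := hp.isStarProjection.isSelfAdjoint
  have hpp : p * p = p := hp.isStarProjection.isIdempotentElem
  have hqs := hq.isStarProjection.isSelfAdjoint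
  have hqq : q * q = q := hq.isStarProjection.isIdempotentElem
  obtain ⟨y, hy⟩ := hs.exists_mul_mul_ne_zero hp.ne_zero (q := q) (by
    rw [hqq, hqq]
    exact hq.ne_zero)
  set u := q * y * p with hu
  have huu : star u * u = p * (star y * q * y) * p := by
    rw [hu, star_mul, star_mul, hps.star_eq, hqs.star_eq]
    simp only [mul_assoc]
    rw [← mul_assoc q q, hqq]
  have hqy : 0 ≤ star y * q * y := star_left_conjugate_nonneg hq.isStarProjection.nonneg y
  obtain ⟨r, hr0, hr⟩ := hT.exists_conjugate_eq_smul hfin hp hqy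
  rw [← huu] at hr
  have hrne : r ≠ 0 := by
    rintro rfl
    rw [zero_smul] at hr
    exact hy (CStarRing.star_mul_self_eq_zero_iff u |>.1 hr)
  have hrpos : 0 < r := lt_of_le_of_ne hr0 hrne.symm
  set v := √r⁻¹ • u with hv
  have hvD : v ∈ D := by
    rw [hv, ← Complex.coe_smul]
    exact SMulMemClass.smul_mem _ (hT.mul_mul_mem q hq.mem y p hp.mem)
  have hvv : star v * v = p := by
    rw [hv, star_smul]
    simp only [star_trivial, smul_mul_assoc, mul_smul_comm, hr]
    rw [smul_smul, smul_smul, Real.mul_self_sqrt (inv_nonneg.2 hr0), inv_mul_cancel₀ hrne,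
      one_smul]
  have hvp : v * p = v := by
    rw [hv, smul_mul_assoc, hu, mul_assoc _ p, hpp]
  have hqv : q * v = v := by
    rw [hv, mul_smul_comm, hu, ← mul_assoc, ← mul_assoc, hqq]
  have hproj : IsStarProjection (v * star v) := by
    refine ⟨?_, IsSelfAdjoint.mul_star_self v⟩
    rw [IsIdempotentElem, mul_assoc, ← mul_assoc (star v), hvv, ← mul_assoc, hvp]
  refine ⟨v, hvD, hvv, ?_⟩
  rcases hq.eq_zero_or_eq _ (mul_mem hvD (star_mem hvD)) hproj (by rw [← mul_assoc, hqv])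
    with h | h
  · have : v = 0 := CStarRing.mul_star_self_eq_zero_iff v |>.1 h
    exact absurd (by rw [← hvv, this]; simp) hp.ne_zero
  · exact h

theorem exists_list_sum_eq (hT : QuasitraceOn D T) (hs : IsSimpleCStar A) (hη : 0 < η)
    (hlow : ∀ p ∈ D, IsStarProjection p → p ≠ 0 → η ≤ T p)
    (hfin : ∀ x ∈ D, 0 ≤ x → (quasispectrum ℝ x).Finite) {p : A} (hp : IsMinimalProjection D p)
    {e : A} (he : e ∈ D) (hee : IsStarProjection e) :
    ∃ l : List A, (∀ v ∈ l, star v * v = p) ∧ (l.map fun v => v * star v).sum = e := by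
  refine hT.projection_induction hη hlow (P := fun e => ∃ l : List A,
    (∀ v ∈ l, star v * v = p) ∧ (l.map fun v => v * star v).sum = e) ⟨[], by simp⟩ ?_ ?_ he hee
  · intro q hq
    obtain ⟨v, -, hv1, hv2⟩ := hT.exists_equivalence hs hfin hp hq
    exact ⟨[v], by simpa using hv1, by simpa using hv2⟩
  · rintro q - q' - - - - - ⟨l, hl, rfl⟩ ⟨l', hl', rfl⟩
    refine ⟨l ++ l', fun v hv => ?_, by simp⟩
    rcases List.mem_append.1 hv with h | h
    exacts [hl v h, hl' v h]

theorem mul_eq_of_star_mul_self_eq {v p : A} (hp : IsStarProjection p) (hv : star v * v = p) :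
    v * p = v := by
  have h := CStarRing.star_mul_self_eq_zero_iff (v * p - v)
  refine sub_eq_zero.1 (h.1 ?_)
  have e1 : p * p = p := hp.isIdempotentElem
  have : star (v * p - v) * (v * p - v)
      = p * (star v * v) * p - p * (star v * v) - star v * v * p + star v * v := by
    rw [star_sub, star_mul, hp.isSelfAdjoint.star_eq]
    noncomm_ring
  rw [this, hv, e1, e1]
  simp

/-- The support projection `e` of `a` is a left unit of `D` and decomposes as `∑ vv⋆` with `v⋆v = p`
minimal. The map `Φ x = ∑ v⋆xv` is the matrix trace times `p`; it is additive, and `T` is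
homogeneous on `ℝp`, so the claim reduces to `T = T ∘ Φ` on positive elements. -/
theorem map_add_of_lt (hT : QuasitraceOn D T) (hs : IsSimpleCStar A) (hη : 0 < η)
    (hlow : ∀ g ∈ D, ∀ s : A, 0 ≤ g → 0 ≤ s → s ≠ 0 → g * s = s → η < T g)
    {a : A} (ha : a ∈ D) (ha0 : 0 ≤ a) (haD : ∀ p, p * a = a → ∀ x ∈ D, p * x = x) {x y : A}
    (hx : x ∈ D) (hy : y ∈ D) (hx0 : 0 ≤ x) (hy0 : 0 ≤ y) : T (x + y) = T x + T y := by
  classical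
  have hfin : ∀ x ∈ D, 0 ≤ x → (quasispectrum ℝ x).Finite := fun x hx hx0 =>
    hT.finite_quasispectrum hη hlow hx hx0
  have hlow' : ∀ p ∈ D, IsStarProjection p → p ≠ 0 → η ≤ T p := fun p hp hpp hp0 =>
    (hlow p hp p hpp.nonneg hpp.nonneg hp0 hpp.isIdempotentElem).le
  obtain ⟨e, he, hee, hea⟩ := exists_isStarProjection_mul_eq_of_finite hT ha ha0 (hfin a ha ha0)
  have heD := haD e hea
  by_cases hmin : ∃ p, IsMinimalProjection D p
  swap
  · have h0 : ∀ p ∈ D, IsStarProjection p → p = 0 := fun p hp hpp =>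
      hT.projection_induction hη hlow' (P := fun p => p = 0) rfl
        (fun q hq => absurd ⟨q, hq⟩ hmin) (fun p _ q _ _ _ _ _ h1 h2 => by rw [h1, h2, add_zero])
        hp hpp
    have he0 := h0 e he hee
    have hD : ∀ x ∈ D, x = 0 := fun x hx => by rw [← heD x hx, he0, zero_mul]
    rw [hD x hx, hD y hy, add_zero, hT.map_zero, add_zero]
  obtain ⟨p, hp⟩ := hmin
  have hpp : p * p = p := hp.isStarProjection.isIdempotentElem
  have hps := hp.isStarProjection.isSelfAdjoint
  obtain ⟨l, hl, hle⟩ := hT.exists_list_sum_eq hs hη hlow' hfin hp he hee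
  have hlp : ∀ v ∈ l, v * p = v := fun v hv =>
    mul_eq_of_star_mul_self_eq hp.isStarProjection (hl v hv)
  have hlp' : ∀ v ∈ l, p * star v = star v := fun v hv => by
    have := congrArg star (hlp v hv)
    rwa [star_mul, hps.star_eq] at this
  let Φ : A → A := fun x => (l.map fun v => star v * x * v).sum
  have hΦadd : ∀ x y, Φ (x + y) = Φ x + Φ y := by
    intro x y
    simp only [Φ, mul_add, add_mul, List.sum_map_add]
  have hΦsmul : ∀ (r : ℝ) x, Φ (r • x) = r • Φ x := by
    intro r x
    simp only [Φ, List.smul_sum, List.map_map]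
    congr 1
    refine List.map_congr_left fun v _ => ?_
    simp [mul_smul_comm, smul_mul_assoc]
  have hΦpos : ∀ x, 0 ≤ x → ∃ r : ℝ, Φ x = r • p := by
    intro x hx
    have : ∀ m : List A, (∀ v ∈ m, v ∈ l) →
        ∃ r : ℝ, (m.map fun v => star v * x * v).sum = r • p := by
      intro m
      induction m with
      | nil => exact fun _ => ⟨0, by simp⟩
      | cons v m ih =>
        intro hm
        obtain ⟨r, hr⟩ := ih fun w hw => hm w (List.mem_cons_of_mem v hw)
        obtain ⟨t, -, ht⟩ := hT.exists_conjugate_eq_smul hfin hp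
          (star_left_conjugate_nonneg hx v)
        have hv := hm v List.mem_cons_self
        have e1 : p * (star v * x * v) * p = star v * x * v := by
          rw [← mul_assoc, ← mul_assoc, hlp' v hv, mul_assoc _ v, hlp v hv]
        rw [e1] at ht
        exact ⟨t + r, by rw [List.map_cons, List.sum_cons, hr, ht, add_smul]⟩
    exact this l fun _ h => h
  have hTΦadd : ∀ x y, 0 ≤ x → 0 ≤ y → T (Φ (x + y)) = T (Φ x) + T (Φ y) := by
    intro x y hx hy
    obtain ⟨r, hr⟩ := hΦpos x hx
    obtain ⟨t, ht⟩ := hΦpos y hy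
    rw [hΦadd, hr, ht, ← add_smul, hT.smul _ p hp.mem hps, hT.smul _ p hp.mem hps,
      hT.smul _ p hp.mem hps]
    ring
  have hTΦsmul : ∀ (r : ℝ) x, 0 ≤ x → T (Φ (r • x)) = r * T (Φ x) := by
    intro r x hx
    obtain ⟨t, ht⟩ := hΦpos x hx
    rw [hΦsmul, ht, smul_smul, hT.smul _ p hp.mem hps, hT.smul _ p hp.mem hps]
    ring
  have hΦmin : ∀ q, IsMinimalProjection D q → Φ q = p := by
    intro q hq
    obtain ⟨w, hwD, hw1, hw2⟩ := hT.exists_equivalence hs hfin hp hq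
    have hwp : w * p = w := mul_eq_of_star_mul_self_eq hp.isStarProjection hw1
    have hwp' : p * star w = star w := by
      have := congrArg star hwp
      rwa [star_mul, hps.star_eq] at this
    -- `w⋆v` is a scalar multiple `cp`, so `(w⋆v)⋆(w⋆v)` and `(w⋆v)(w⋆v)⋆` agree. Summing over `v`
    -- then gives `w⋆ew = w⋆w = p`.
    have h1 : ∀ v ∈ l, star v * q * v = star w * (v * star v) * w := by
      intro v hv
      obtain ⟨c, hc⟩ := hT.exists_conjugate_eq_complex_smul hfin hp (star w * v)
      have e1 : p * (star w * v) * p = star w * v := by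
        rw [← mul_assoc, hwp', mul_assoc, hlp v hv]
      rw [e1] at hc
      have e2 : star v * q * v = star (star w * v) * (star w * v) := by
        rw [← hw2]
        simp only [star_mul, star_star, mul_assoc]
      have e3 : star w * (v * star v) * w = star w * v * star (star w * v) := by
        simp only [star_mul, star_star, mul_assoc]
      rw [e2, e3, hc, star_smul, hps.star_eq]
      simp only [smul_mul_assoc, mul_smul_comm]
      rw [smul_comm]
    have h2 : ∀ m : List A, (m.map fun v => star w * (v * star v) * w).sum
        = star w * (m.map fun v => v * star v).sum * w := by
      intro m
      induction m with
      | nil => simp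
      | cons v m ih => rw [List.map_cons, List.sum_cons, ih, List.map_cons, List.sum_cons, mul_add,
          add_mul]
    change (l.map fun v => star v * q * v).sum = p
    rw [List.map_congr_left h1, h2, hle, mul_assoc, heD w hwD, hw1]
  have hproj : ∀ q ∈ D, IsStarProjection q → T q = T (Φ q) := by
    intro q hq hqq
    refine hT.projection_induction hη hlow' (P := fun q => T q = T (Φ q)) ?_ ?_ ?_ hq hqq
    · simp [Φ]
    · intro q hq
      obtain ⟨w, hwD, hw1, hw2⟩ := hT.exists_equivalence hs hfin hp hq
      rw [hΦmin q hq, ← hw1, ← hw2]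
      exact (hT.tracial w hwD).symm
    · intro q hq q' hq' hqq hqq' h1 h2 h3 h4
      rw [hT.add_of_commute q hq q' hq' hqq.isSelfAdjoint hqq'.isSelfAdjoint (h1.trans h2.symm),
        hTΦadd _ _ hqq.nonneg hqq'.nonneg, h3, h4]
  -- The spectral projections of `x` commute, so `T` is additive along the spectral decomposition
  -- and the case of projections suffices.
  have hpos : ∀ x ∈ D, 0 ≤ x → T x = T (Φ x) := by
    intro x hx hx0
    obtain ⟨S, hS0, hSp, -, hsum⟩ := exists_cfcₙ_eq_sum_of_finite hx0 (hfin x hx hx0)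
    let q : ℝ → A := fun l => cfcₙ (fun t => if t = l then (1 : ℝ) else 0) x
    have hqD : ∀ l, q l ∈ D := fun l => hT.cfcₙ_mem _ hx
    have hlqD : ∀ l, l • q l ∈ D := fun l => by
      rw [← Complex.coe_smul]
      exact SMulMemClass.smul_mem _ (hqD l)
    have hqs : ∀ l : ℝ, IsSelfAdjoint (l • q l) := fun l =>
      (IsSelfAdjoint.all l).smul (isSelfAdjoint_cfcₙ _ x)
    have hcomm : ∀ k l, Commute (q k) (q l) := fun k l => cfcₙ_commute_cfcₙ _ _ _
    have key : ∀ R ⊆ S, T (∑ l ∈ R, l • q l) = T (Φ (∑ l ∈ R, l • q l)) := by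
      intro R
      induction R using Finset.induction_on with
      | empty => simp [Φ]
      | insert i R hi ih =>
        intro hR
        have hiS : i ∈ S := hR (Finset.mem_insert_self i R)
        have hRS : R ⊆ S := fun j hj => hR (Finset.mem_insert_of_mem hj)
        have hqi : 0 ≤ q i := (hSp i hiS).nonneg
        rw [Finset.sum_insert hi, hT.add_of_commute _ (hlqD i) _ (sum_mem fun j _ => hlqD j) (hqs i)
          (isSelfAdjoint_sum R fun j _ => hqs j)
          (Commute.sum_right R _ _ fun j _ => ((hcomm i j).smul_left i).smul_right j),
          hTΦadd _ _ (smul_nonneg (hS0 i hiS).le hqi)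
            (Finset.sum_nonneg fun j hj => smul_nonneg (hS0 j (hRS hj)).le (hSp j (hRS hj)).nonneg),
          ih hRS, hT.smul i _ (hqD i) (isSelfAdjoint_cfcₙ _ x), hTΦsmul i _ hqi,
          hproj _ (hqD i) (hSp i hiS)]
    rw [hsum]
    exact key S subset_rfl
  rw [hpos _ (add_mem hx hy) (add_nonneg hx0 hy0), hpos x hx hx0, hpos y hy hy0,
    hTΦadd x y hx0 hy0]

end QuasitraceOn

end Discrete

/-! ### Conclusion: the dichotomy -/

theorem IsPos.add {B : Type*} [NonUnitalCStarAlgebra B] {x y : B} (hx : IsPos x) (hy : IsPos y) :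
    IsPos (x + y) := by
  let _ : PartialOrder B := CStarAlgebra.spectralOrder B
  have : StarOrderedRing B := CStarAlgebra.spectralOrderedRing B
  rw [isPos_iff_nonneg] at *
  exact add_nonneg hx hy

theorem IsQuasitrace.isTrace_of_map_add_of_isPos {B : Type*} [NonUnitalCStarAlgebra B] {τ : B → ℂ}
    (hτ : IsQuasitrace τ) (h : ∀ x y : B, IsPos x → IsPos y → τ (x + y) = τ x + τ y) :
    IsTrace τ := by
  let _ : PartialOrder B := CStarAlgebra.spectralOrder B
  have : StarOrderedRing B := CStarAlgebra.spectralOrderedRing B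
  exact hτ.isTrace_of_map_add fun x y hx hy =>
    h x y (isPos_iff_nonneg.2 hx) (isPos_iff_nonneg.2 hy)

end CStarTracial

open CStarTracial in
theorem mainTheorem11 {A : Type u} [NonUnitalCStarAlgebra A]
    (hsimple : CStarTracial.IsSimpleCStar A)
    (hA : CStarTracial.EssentiallyTraciallyIn A
      (fun (B : Type u) [NonUnitalCStarAlgebra B] => CStarTracial.InClassT B)) :
    CStarTracial.InClassT A := by
  intro a ha _ _ τ hτ
  let _ : PartialOrder A := CStarAlgebra.spectralOrder A
  have : StarOrderedRing A := CStarAlgebra.spectralOrderedRing A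
  have hT : QuasitraceOn (her a ha.isSelfAdjoint) (reExtend _ τ) :=
    hτ.quasitraceOn fun x hx b y hy => mul_mul_mem_her hx b hy
  have hadd : ∀ x ∈ her a ha.isSelfAdjoint, ∀ y ∈ her a ha.isSelfAdjoint, 0 ≤ x → 0 ≤ y →
      reExtend _ τ (x + y) = reExtend _ τ x + reExtend _ τ y := by
    intro x hx y hy hx0 hy0
    -- Either the values of `T` on local units of nonzero positive elements have infimum zero, or
    -- they are bounded below by a positive constant.
    by_cases hsmall : ∀ η > 0, ∃ g ∈ her a ha.isSelfAdjoint, ∃ s : A, 0 ≤ g ∧ 0 ≤ s ∧ s ≠ 0 ∧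
        g * s = s ∧ reExtend (her a ha.isSelfAdjoint) τ g ≤ η
    · exact hτ.reExtend_add_of_small hA hsmall hx hy hx0 hy0
    · push Not at hsmall
      obtain ⟨η, hη, hlow⟩ := hsmall
      exact hT.map_add_of_lt hsimple hη hlow (self_mem_her ha) (isPos_iff_nonneg.1 ha)
        (fun p hp x hx => mul_eq_of_mem_her hp hx) hx hy hx0 hy0
  -- On positive elements `τ` has no imaginary part, so nothing is lost in passing to `reExtend`.
  have hreal : ∀ z : her a ha.isSelfAdjoint, IsPos z →
      τ z = (reExtend _ τ (z : A) : ℂ) ∧ 0 ≤ (z : A) := by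
    rintro _ ⟨w, rfl⟩
    rw [reExtend_coe]
    exact ⟨Complex.ext rfl (Complex.nonneg_iff.1 (hτ.1.nonneg w)).2.symm,
      star_mul_self_nonneg (w : A)⟩
  refine hτ.1.isTrace_of_map_add_of_isPos fun x y hx hy => ?_
  obtain ⟨hx1, hx2⟩ := hreal x hx
  obtain ⟨hy1, hy2⟩ := hreal y hy
  rw [(hreal (x + y) (hx.add hy)).1, hx1, hy1, ← Complex.ofReal_add]
  exact congrArg _ (hadd x x.2 y y.2 hx2 hy2)
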